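/- Let $n\ge 1$ be an integer and $p\ge 1$, $\frac1p+\frac1q=1$ (with $\frac1q=0$ if $p=1$). For $\lambda,t\in[0,1]$ put $$C_{p,\lambda,t}=(1-t)^{1/p}(1-\lambda)^{1/q},\qquad D_{p,\lambda,t}=t^{1/p}\lambda^{1/q}\qquad(0^0=1).$$ For $s\in[-\infty,\infty]$, $c,d\ge 0$ and $a,b\in[0,\infty]$ let $M_s^{(c,d)}(a,b)=0$ if $ab=0$, and otherwise let $M_s^{(c,d)}(a,b)$ be $(ca^s+db^s)^{1/s}$ if $s\ne 0,\pm\infty$ (computed in $[0,\infty]$, so that $0^{1/s}=\infty$ for $s<0$), $a^cb^d$ if $s=0$, $\max\{a,b\}$ if $s=+\infty$, and $\min\{a,b\}$ if $s=-\infty$. A function $F\colon\mathbb R^n\to[0,\infty]$ is called $L_{p,s}$-concave if $$F(C_{p,\lambda,t}x+D_{p,\lambda,t}y)\ \ge\ M_s^{(C_{p,\lambda,t},D_{p,\lambda,t})}(F(x),F(y))$$ for all $x,y\in\mathbb R^n$ and all $\lambda,t\in[0,1]$; for $r\in\mathbb R$ it is called $L_{p,r}$-quasi-concave if $$F(C_{p,\lambda,t}x+D_{p,\lambda,t}y)\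 \ge\ \min\{C_{p,\lambda,t}^{\,r}F(x),\,D_{p,\lambda,t}^{\,r}F(y)\}$$ for all $x,y\in\mathbb R^n$ and all $\lambda,t\in[0,1]$. Let $s,\beta\in[-\infty,+\infty]$ be such that $s+\beta\ge 0$ (in particular, $s+\beta$ is not of the form $\infty-\infty$), and suppose that $s\neq0$ and $\beta\ne 0$, unless $p=1$. Let $f,g\colon\mathbb R^n\to[0,\infty)$ be $L_{p,s}$-concave and $L_{p,\beta}$-concave, respectively. Then the convolution $(f*g)(z)=\int_{\mathbb R^n}f(x)g(z-x)\,dx\in[0,\infty]$ 1. is $L_{p,(s^{-1}+\beta^{-1}+n)^{-1}}$-concave if $\frac{s\beta}{s+\beta}\ge-\frac1n$; 2. is $L_{p,(s^{-1}+\beta^{-1}+n)}$-quasi-concave if $\frac{s\beta}{s+\beta}<-\frac1n$. Here $\frac{s\beta}{s+\beta}$ is read as $\beta$ if $s=+\infty$, as $s$ if $\beta=+\infty$, as $-\infty$ if $s=-\beta\neq0$, and as $0$ if $s=\beta=0$; $(\pm\infty)^{-1}=0$; and the index $(s^{-1}+\beta^{-1}+n)^{-1}$ is read as $-\infty$ if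 $\frac{s\beta}{s+\beta}=-\frac1n$, and as $0$ if $s=0$ or $\beta=0$. -/

import Mathlib

open MeasureTheory
open scoped NNReal ENNReal

noncomputable section

/-- The coefficient `C_{p,lam,t} = (1-t)^(1/p) (1-lam)^(1/q)`, where `1/q = 1 - 1/p`
(so `1/q = 0`, and the second factor is `1`, when `p = 1`). -/
def lpCoeffC (p lam t : ℝ) : ℝ := (1 - t) ^ (1 / p) * (1 - lam) ^ (1 - 1 / p)

/-- The coefficient `D_{p,lam,t} = t^(1/p) lam^(1/q)`, where `1/q = 1 - 1/p`. -/
def lpCoeffD (p lam t : ℝ) : ℝ := t ^ (1 / p) * lam ^ (1 - 1 / p)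

open Classical in
/-- The `s`-mean `M_s^{(c,d)}(a,b)` of `a, b ∈ [0,∞]` with coefficients `c, d ≥ 0`.
It vanishes unless `ab > 0`. In the power case the arithmetic is that of `[0,∞]`; in particular
`0 ^ (1/s) = ∞` for `s < 0`, which is the value for `c = d = 0`. -/
def sMean (s : EReal) (c d : ℝ) (a b : ℝ≥0∞) : ℝ≥0∞ :=
  if a = 0 ∨ b = 0 then 0
  else if s = ⊤ then max a b
  else if s = ⊥ then min a b
  else if s = 0 then a ^ c * b ^ d
  else (ENNReal.ofReal c * a ^ s.toReal + ENNReal.ofReal d * b ^ s.toReal) ^ (1 / s.toReal)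

/-- `L_{p,s}`-concavity of a function with values in `[0,∞]`. -/
def IsLpConcave {n : ℕ} (p : ℝ) (s : EReal) (F : EuclideanSpace ℝ (Fin n) → ℝ≥0∞) : Prop :=
  ∀ x y : EuclideanSpace ℝ (Fin n), ∀ lam ∈ Set.Icc (0 : ℝ) 1, ∀ t ∈ Set.Icc (0 : ℝ) 1,
    sMean s (lpCoeffC p lam t) (lpCoeffD p lam t) (F x) (F y) ≤
      F (lpCoeffC p lam t • x + lpCoeffD p lam t • y)

/-- `L_{p,r}`-quasi-concavity of a function with values in `[0,∞]`. -/
def IsLpQuasiConcave {n : ℕ} (p r : ℝ) (F : EuclideanSpace ℝ (Fin n) → ℝ≥0∞) : Prop :=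
  ∀ x y : EuclideanSpace ℝ (Fin n), ∀ lam ∈ Set.Icc (0 : ℝ) 1, ∀ t ∈ Set.Icc (0 : ℝ) 1,
    min (ENNReal.ofReal (lpCoeffC p lam t) ^ r * F x)
        (ENNReal.ofReal (lpCoeffD p lam t) ^ r * F y) ≤
      F (lpCoeffC p lam t • x + lpCoeffD p lam t • y)

/-- The convolution `(f * g)(z) = ∫ f(x) g(z - x) dx` of two nonnegative functions,
with values in `[0,∞]`. -/
def convol {n : ℕ} (f g : EuclideanSpace ℝ (Fin n) → ℝ≥0) :
    EuclideanSpace ℝ (Fin n) → ℝ≥0∞ :=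
  fun z => ∫⁻ x, (f x : ℝ≥0∞) * (g (z - x) : ℝ≥0∞)

open Classical in
/-- The quantity `s b / (s + b)` for extended reals `s, b` with `s + b ≥ 0`, with the limit values
`b` for `s = ∞`, `s` for `b = ∞`, and `-∞` for `s = -b ≠ 0`. For `s = b = 0` it is `0`. -/
def parallelSum (s b : EReal) : EReal :=
  if s = ⊤ then b
  else if b = ⊤ then s
  else if s + b = 0 ∧ s ≠ 0 then ⊥
  else s * b / (s + b)

open Classical in
/-- The index `(s⁻¹ + b⁻¹ + n)⁻¹`, with `1/∞ = 0`; it is `0` if `s` or `b` is `0` (where `1/0 = ∞`)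
and `-∞` if `s⁻¹ + b⁻¹ + n = 0`, that is, if `s b / (s + b) = -1/n`. -/
def convolIndex (n : ℕ) (s b : EReal) : EReal :=
  if s = 0 ∨ b = 0 then 0
  else if s⁻¹ + b⁻¹ + (n : EReal) = 0 then ⊥
  else (s⁻¹ + b⁻¹ + (n : EReal))⁻¹

end

open Filter Topology

/-! ### Elementary properties of the means `sMean` -/

/-! Fix `x₀`, `y₀` and coefficients `c`, `d`. The integrands `f x * g (x₀ - x)`, `f y * g (y₀ - y)`
and `f z * g (c • x₀ + d • y₀ - z)` satisfy the hypothesis of a Borell-Brascamp-Lieb inequality: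
multiplying the two concavity estimates and applying Hölder's inequality for means gives an index
whose reciprocal is `s⁻¹ + β⁻¹`. Integration over `ℝⁿ` then adds `n` to that reciprocal. Reciprocals
add throughout, so indices are encoded by them (`recipIndex`).

Since `c + d = 1` fails for `p > 1`, the integral inequality is proved for general `c, d ≥ 0`. Its
geometric core is the linear bound `c ^ n * μ A + d ^ n * μ B ≤ μ S` whenever `c • A + d • B ⊆ S`
(`measure_combination_ge`). Applied to superlevel sets of functions normalised to supremum 1, it
yields `lintegral_combination_ge`. On the line, a second use of Hölder with the arithmetic mean
raises the reciprocal by 1, and Fubini iterates this (`sMean_lintegral_le`). A negative reciprocal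
`ρ` survives `n` such steps exactly when `ρ ≤ -n`. Otherwise the iteration stops at a reciprocal in
`[-1, 0]`, and the linear bound in the remaining dimension gives the Dancs-Uhrin minimum
(`min_lintegral_le`).

An index can be negative with nonzero functions only for `p = 1`: for `p > 1` both coefficients can
vanish, and the mean `0 ^ (1 / s) = ∞` contradicts finiteness (`IsLpConcave.eq_zero_of_neg`). -/

theorem sMean_of_eq_zero {s : EReal} {c d : ℝ} {a b : ℝ≥0∞} (h : a = 0 ∨ b = 0) :
    sMean s c d a b = 0 := by
  simp [sMean, h]

theorem sMean_top {c d : ℝ} {a b : ℝ≥0∞} (ha : a ≠ 0) (hb : b ≠ 0) :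
    sMean ⊤ c d a b = max a b := by
  simp [sMean, ha, hb]

theorem sMean_bot {c d : ℝ} {a b : ℝ≥0∞} (ha : a ≠ 0) (hb : b ≠ 0) :
    sMean ⊥ c d a b = min a b := by
  simp [sMean, ha, hb]

theorem sMean_zero {c d : ℝ} {a b : ℝ≥0∞} (ha : a ≠ 0) (hb : b ≠ 0) :
    sMean 0 c d a b = a ^ c * b ^ d := by
  simp [sMean, ha, hb]

theorem sMean_coe {s : ℝ} (hs : s ≠ 0) {c d : ℝ} {a b : ℝ≥0∞} (ha : a ≠ 0) (hb : b ≠ 0) :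
    sMean (s : EReal) c d a b =
      (ENNReal.ofReal c * a ^ s + ENNReal.ofReal d * b ^ s) ^ (1 / s) := by
  simp [sMean, ha, hb, hs]

theorem ENNReal.rpow_le_rpow_of_nonpos' {a b : ℝ≥0∞} {z : ℝ} (hz : z ≤ 0) (h : a ≤ b) :
    b ^ z ≤ a ^ z := by
  rw [← neg_neg z, ENNReal.rpow_neg, ENNReal.rpow_neg a]
  exact ENNReal.inv_le_inv.2 (ENNReal.rpow_le_rpow h (by linarith))

theorem sMean_mono {s : EReal} {c d : ℝ} (hc : 0 ≤ c) (hd : 0 ≤ d) {a b a' b' : ℝ≥0∞}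
    (ha : a ≤ a') (hb : b ≤ b') : sMean s c d a b ≤ sMean s c d a' b' := by
  by_cases h : a = 0 ∨ b = 0
  · simp [sMean_of_eq_zero h]
  push Not at h
  obtain ⟨ha0, hb0⟩ := h
  have ha0' : a' ≠ 0 := fun h => ha0 (le_antisymm (h ▸ ha) zero_le)
  have hb0' : b' ≠ 0 := fun h => hb0 (le_antisymm (h ▸ hb) zero_le)
  induction s with
  | top => rw [sMean_top ha0 hb0, sMean_top ha0' hb0']; exact max_le_max ha hb
  | bot => rw [sMean_bot ha0 hb0, sMean_bot ha0' hb0']; exact min_le_min ha hb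
  | coe s =>
    rcases eq_or_ne s 0 with rfl | hs
    · rw [EReal.coe_zero, sMean_zero ha0 hb0, sMean_zero ha0' hb0']
      gcongr
    · rw [sMean_coe hs ha0 hb0, sMean_coe hs ha0' hb0']
      rcases lt_or_gt_of_ne hs with hs | hs
      · apply ENNReal.rpow_le_rpow_of_nonpos' (one_div_nonpos.2 hs.le)
        gcongr ?_ * ?_ + ?_ * ?_
        · exact le_rfl
        · exact ENNReal.rpow_le_rpow_of_nonpos' hs.le ha
        · exact le_rfl
        · exact ENNReal.rpow_le_rpow_of_nonpos' hs.le hb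
      · have : 0 ≤ 1 / s := by positivity
        gcongr

/-- The geometric mean is homogeneous of degree `c + d`, hence the condition at `s = 0`; all other
means have degree 1 for any coefficients. -/
theorem sMean_mul_left {s : EReal} {c d : ℝ} (hc : 0 ≤ c) (hd : 0 ≤ d)
    (hs0 : s = 0 → c + d = 1) {a b m : ℝ≥0∞} (hm : m ≠ 0) (hm' : m ≠ ∞)
    (ha : a ≠ 0) (hb : b ≠ 0) :
    sMean s c d (m * a) (m * b) = m * sMean s c d a b := by
  have hma : m * a ≠ 0 := mul_ne_zero hm ha
  have hmb : m * b ≠ 0 := mul_ne_zero hm hb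
  induction s with
  | top =>
    rw [sMean_top ha hb, sMean_top hma hmb]
    exact (mul_right_mono.map_max (f := fun x => m * x)).symm
  | bot =>
    rw [sMean_bot ha hb, sMean_bot hma hmb]
    exact (mul_right_mono.map_min (f := fun x => m * x)).symm
  | coe s =>
    rcases eq_or_ne s 0 with rfl | hs
    · rw [EReal.coe_zero, sMean_zero ha hb, sMean_zero hma hmb, ENNReal.mul_rpow_of_nonneg _ _ hc,
        ENNReal.mul_rpow_of_nonneg _ _ hd, mul_mul_mul_comm, ← ENNReal.rpow_add _ _ hm hm',
        hs0 (by simp), ENNReal.rpow_one]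
    · rw [sMean_coe hs ha hb, sMean_coe hs hma hmb]
      have key : ∀ x : ℝ≥0∞, (m * x) ^ s = m ^ s * x ^ s := fun x =>
        ENNReal.mul_rpow_eq_ite m x s |>.trans (by simp [hm, hm'])
      have key' : ∀ x : ℝ≥0∞, (m ^ s * x) ^ (1 / s) = m * x ^ (1 / s) := fun x => by
        have h1 : m ^ s ≠ 0 := (ENNReal.rpow_pos (pos_iff_ne_zero.2 hm) hm').ne'
        have h2 : m ^ s ≠ ∞ := ENNReal.rpow_ne_top_of_ne_zero hm hm'
        rw [ENNReal.mul_rpow_eq_ite]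
        simp only [h1, h2, false_and, or_false, if_false]
        rw [← ENNReal.rpow_mul, mul_one_div_cancel hs, ENNReal.rpow_one]
      rw [key, key, ← key']
      congr 1
      ring

theorem sMean_self {s : EReal} {c d : ℝ} (hc : 0 ≤ c) (hd : 0 ≤ d) (hcd : c + d = 1) {a : ℝ≥0∞}
    (ha : a ≠ 0) (ha' : a ≠ ∞) : sMean s c d a a = a := by
  induction s with
  | top => rw [sMean_top ha ha, max_self]
  | bot => rw [sMean_bot ha ha, min_self]
  | coe s =>
    rcases eq_or_ne s 0 with rfl | hs
    · rw [EReal.coe_zero, sMean_zero ha ha, ← ENNReal.rpow_add _ _ ha ha', hcd, ENNReal.rpow_one]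
    · rw [sMean_coe hs ha ha, ← add_mul, ← ENNReal.ofReal_add hc hd, hcd, ENNReal.ofReal_one,
        one_mul, ← ENNReal.rpow_mul, mul_one_div_cancel hs, ENNReal.rpow_one]

theorem min_le_sMean {s : EReal} {c d : ℝ} (hc : 0 ≤ c) (hd : 0 ≤ d) (hcd : c + d = 1)
    {a b : ℝ≥0∞} (h : min a b ≠ ∞) : min a b ≤ sMean s c d a b := by
  rcases eq_or_ne (min a b) 0 with h0 | h0
  · simp [h0]
  · calc min a b = sMean s c d (min a b) (min a b) := (sMean_self hc hd hcd h0 h).symm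
      _ ≤ _ := sMean_mono hc hd (min_le_left _ _) (min_le_right _ _)

theorem weighted_sum_ne_zero {c d : ℝ} (hcd : 0 < c + d) {x y : ℝ≥0∞}
    (hx : x ≠ 0) (hy : y ≠ 0) : ENNReal.ofReal c * x + ENNReal.ofReal d * y ≠ 0 := by
  intro h
  rw [add_eq_zero, mul_eq_zero, mul_eq_zero] at h
  simp only [hx, hy, or_false, ENNReal.ofReal_eq_zero] at h
  linarith [h.1, h.2]

theorem weighted_sum_ne_top {c d : ℝ} {x y : ℝ≥0∞} (hx : x ≠ ∞) (hy : y ≠ ∞) :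
    ENNReal.ofReal c * x + ENNReal.ofReal d * y ≠ ∞ :=
  ENNReal.add_ne_top.2
    ⟨ENNReal.mul_ne_top ENNReal.ofReal_ne_top hx, ENNReal.mul_ne_top ENNReal.ofReal_ne_top hy⟩

theorem rpow_ne_zero_of_ne {x : ℝ≥0∞} (hx : x ≠ 0) (hx' : x ≠ ∞) (y : ℝ) : x ^ y ≠ 0 :=
  (ENNReal.rpow_pos (pos_iff_ne_zero.2 hx) hx').ne'

theorem sMean_ne_zero_ne_top {s : EReal} {c d : ℝ} (hcd : 0 < c + d)
    {a b : ℝ≥0∞} (ha : a ≠ 0) (ha' : a ≠ ∞) (hb : b ≠ 0) (hb' : b ≠ ∞) :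
    sMean s c d a b ≠ 0 ∧ sMean s c d a b ≠ ∞ := by
  induction s with
  | top => rw [sMean_top ha hb]; rcases max_choice a b with h | h <;> rw [h] <;> simp [*]
  | bot => rw [sMean_bot ha hb]; rcases min_choice a b with h | h <;> rw [h] <;> simp [*]
  | coe s =>
    rcases eq_or_ne s 0 with rfl | hs
    · rw [EReal.coe_zero, sMean_zero ha hb]
      exact ⟨mul_ne_zero (rpow_ne_zero_of_ne ha ha' _) (rpow_ne_zero_of_ne hb hb' _),
        ENNReal.mul_ne_top (ENNReal.rpow_ne_top_of_ne_zero ha ha')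
          (ENNReal.rpow_ne_top_of_ne_zero hb hb')⟩
    · rw [sMean_coe hs ha hb]
      have h1 := weighted_sum_ne_zero hcd (rpow_ne_zero_of_ne ha ha' s)
        (rpow_ne_zero_of_ne hb hb' s)
      have h2 := weighted_sum_ne_top (c := c) (d := d)
        (ENNReal.rpow_ne_top_of_ne_zero ha ha' (y := s))
        (ENNReal.rpow_ne_top_of_ne_zero hb hb' (y := s))
      exact ⟨rpow_ne_zero_of_ne h1 h2 _, ENNReal.rpow_ne_top_of_ne_zero h1 h2⟩

/-- The limits may be infinite: this carries inequalities from truncated functions to integrals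
equal to `∞`. -/
theorem tendsto_sMean {s : EReal} {c d : ℝ} (hc : 0 ≤ c) (hd : 0 ≤ d) {a b : ℝ≥0∞} (ha : a ≠ 0)
    (hb : b ≠ 0) {u v : ℕ → ℝ≥0∞} (hu : Tendsto u atTop (𝓝 a)) (hv : Tendsto v atTop (𝓝 b)) :
    Tendsto (fun k => sMean s c d (u k) (v k)) atTop (𝓝 (sMean s c d a b)) := by
  have hu0 : ∀ᶠ k in atTop, u k ≠ 0 := hu.eventually_ne ha
  have hv0 : ∀ᶠ k in atTop, v k ≠ 0 := hv.eventually_ne hb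
  induction s with
  | top =>
    rw [sMean_top ha hb]
    refine (hu.max hv).congr' ?_
    filter_upwards [hu0, hv0] with k h1 h2 using (sMean_top h1 h2).symm
  | bot =>
    rw [sMean_bot ha hb]
    refine (hu.min hv).congr' ?_
    filter_upwards [hu0, hv0] with k h1 h2 using (sMean_bot h1 h2).symm
  | coe s =>
    have cont : ∀ z : ℝ, ∀ {x : ℝ≥0∞} {w : ℕ → ℝ≥0∞}, Tendsto w atTop (𝓝 x) →
        Tendsto (fun k => w k ^ z) atTop (𝓝 (x ^ z)) := fun z x w h =>
      ((ENNReal.continuous_rpow_const (y := z)).tendsto x).comp h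
    rcases eq_or_ne s 0 with rfl | hs
    · rw [EReal.coe_zero, sMean_zero ha hb]
      have pos : ∀ {x : ℝ≥0∞} {z : ℝ}, x ≠ 0 → 0 ≤ z → x ^ z ≠ 0 := fun hx hz h => by
        rcases ENNReal.rpow_eq_zero_iff.1 h with h | h
        · exact hx h.1
        · linarith [h.2]
      refine (ENNReal.Tendsto.mul (cont c hu) (Or.inl (pos ha hc)) (cont d hv)
        (Or.inl (pos hb hd))).congr' ?_
      filter_upwards [hu0, hv0] with k h1 h2 using (sMean_zero h1 h2).symm
    · rw [sMean_coe hs ha hb]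
      refine (cont (1 / s) ((ENNReal.Tendsto.const_mul (cont s hu) (Or.inr ENNReal.ofReal_ne_top)).add
        (ENNReal.Tendsto.const_mul (cont s hv) (Or.inr ENNReal.ofReal_ne_top)))).congr' ?_
      filter_upwards [hu0, hv0] with k h1 h2 using (sMean_coe hs h1 h2).symm

/-! ### Hölder's inequality for `sMean` -/

/-- The extended real with reciprocal `ρ`, where `e` (one of `±∞`) is the value for `ρ = 0`. -/
noncomputable def recipIndex (e : EReal) (ρ : ℝ) : EReal := if ρ = 0 then e else ((ρ⁻¹ : ℝ) : EReal)

theorem recipIndex_zero (e : EReal) : recipIndex e 0 = e := if_pos rfl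

theorem recipIndex_ne_zero {e : EReal} (he : e ≠ 0) (ρ : ℝ) : recipIndex e ρ ≠ 0 := by
  unfold recipIndex
  split_ifs with h
  · exact he
  · exact_mod_cast inv_ne_zero h

theorem sMean_recipIndex {e : EReal} {ρ : ℝ} (hρ : ρ ≠ 0) {c d : ℝ} {a b : ℝ≥0∞} (ha : a ≠ 0)
    (hb : b ≠ 0) : sMean (recipIndex e ρ) c d a b =
      (ENNReal.ofReal c * a ^ ρ⁻¹ + ENNReal.ofReal d * b ^ ρ⁻¹) ^ ρ := by
  rw [recipIndex, if_neg hρ, sMean_coe (inv_ne_zero hρ) ha hb, one_div, inv_inv]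

theorem sMean_one {c d : ℝ} {a b : ℝ≥0∞} (ha : a ≠ 0) (hb : b ≠ 0) :
    sMean (recipIndex ⊤ 1) c d a b = ENNReal.ofReal c * a + ENNReal.ofReal d * b := by
  simp [sMean_recipIndex one_ne_zero ha hb]

/-- Two-term Hölder with exponents `1/θ` and `1/(1-θ)`, each weight being split as `e = e ^ θ * e ^
(1 - θ)`. -/
theorem weighted_holder {c d x y x' y' : ℝ≥0∞} {θ : ℝ} (h0 : 0 < θ) (h1 : θ < 1) :
    c * (x ^ θ * y ^ (1 - θ)) + d * (x' ^ θ * y' ^ (1 - θ)) ≤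
      (c * x + d * x') ^ θ * (c * y + d * y') ^ (1 - θ) := by
  have h1' : 0 < 1 - θ := by linarith
  have hpq : (θ⁻¹).HolderConjugate (1 - θ)⁻¹ := by
    rw [Real.holderConjugate_iff]
    exact ⟨(one_lt_inv₀ h0).2 h1, by simp⟩
  have key : ∀ e z z' : ℝ≥0∞, (e * z) ^ θ * (e * z') ^ (1 - θ) = e * (z ^ θ * z' ^ (1 - θ)) := by
    intro e z z'
    rw [ENNReal.mul_rpow_of_nonneg _ _ h0.le, ENNReal.mul_rpow_of_nonneg _ _ h1'.le,
      mul_mul_mul_comm, ← ENNReal.rpow_add_of_nonneg _ _ h0.le h1'.le]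
    simp
  have := ENNReal.inner_le_Lp_mul_Lq Finset.univ ![(c * x) ^ θ, (d * x') ^ θ]
    ![(c * y) ^ (1 - θ), (d * y') ^ (1 - θ)] hpq
  simpa [Fin.sum_univ_two, key, ← ENNReal.rpow_mul, h0.ne', h1'.ne'] using this

section

variable {c d : ℝ} {a b a' b' : ℝ≥0∞}

theorem max_rpow_mul_le {m : ℝ≥0∞} {r : ℝ} (hr : 0 ≤ r) (ha : a ≤ m) (hb : b ≤ m) :
    ENNReal.ofReal c * (a * a') ^ r + ENNReal.ofReal d * (b * b') ^ r ≤
      m ^ r * (ENNReal.ofReal c * a' ^ r + ENNReal.ofReal d * b' ^ r) := by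
  calc _ ≤ ENNReal.ofReal c * (m * a') ^ r + ENNReal.ofReal d * (m * b') ^ r := by gcongr
    _ = _ := by
      rw [ENNReal.mul_rpow_of_nonneg _ _ hr, ENNReal.mul_rpow_of_nonneg _ _ hr]
      ring

theorem le_max_rpow_mul {m : ℝ≥0∞} {r : ℝ} (hr : r ≤ 0) (hm : m ≠ 0) (hm' : m ≠ ∞)
    (ha : a ≤ m) (hb : b ≤ m) :
    m ^ r * (ENNReal.ofReal c * a' ^ r + ENNReal.ofReal d * b' ^ r) ≤
      ENNReal.ofReal c * (a * a') ^ r + ENNReal.ofReal d * (b * b') ^ r := by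
  have key : ∀ x : ℝ≥0∞, (m * x) ^ r = m ^ r * x ^ r := fun x =>
    ENNReal.mul_rpow_eq_ite m x r |>.trans (by simp [hm, hm'])
  calc _ = ENNReal.ofReal c * (m * a') ^ r + ENNReal.ofReal d * (m * b') ^ r := by
        rw [key, key]; ring
    _ ≤ _ := by
      gcongr ?_ * ?_ + ?_ * ?_
      · exact le_rfl
      · exact ENNReal.rpow_le_rpow_of_nonpos' hr (by gcongr)
      · exact le_rfl
      · exact ENNReal.rpow_le_rpow_of_nonpos' hr (by gcongr)

theorem sMean_top_mul_pos {τ : ℝ} (hτ : 0 ≤ τ)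
    (ha : a ≠ 0) (hb : b ≠ 0) (ha' : a' ≠ 0) (hb' : b' ≠ 0) :
    sMean (recipIndex ⊤ τ) c d (a * a') (b * b') ≤
      sMean ⊤ c d a b * sMean (recipIndex ⊤ τ) c d a' b' := by
  have hA := mul_ne_zero ha ha'
  have hB := mul_ne_zero hb hb'
  rw [sMean_top ha hb]
  rcases hτ.eq_or_lt with rfl | hτ
  · rw [recipIndex_zero, sMean_top hA hB, sMean_top ha' hb']
    exact max_le (mul_le_mul' (le_max_left _ _) (le_max_left _ _))
      (mul_le_mul' (le_max_right _ _) (le_max_right _ _))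
  · rw [sMean_recipIndex hτ.ne' hA hB, sMean_recipIndex hτ.ne' ha' hb']
    calc _ ≤ ((max a b) ^ τ⁻¹ *
            (ENNReal.ofReal c * a' ^ τ⁻¹ + ENNReal.ofReal d * b' ^ τ⁻¹)) ^ τ := by
          gcongr
          exact max_rpow_mul_le (by positivity) (le_max_left _ _) (le_max_right _ _)
      _ = _ := by
        rw [ENNReal.mul_rpow_of_nonneg _ _ hτ.le, ENNReal.rpow_inv_rpow hτ.ne']

/-- Hölder's inequality for means of positive indices `1 / σ` and `1 / τ`. -/
theorem sMean_mul_le_pos {σ τ : ℝ} (hσ : 0 ≤ σ) (hτ : 0 ≤ τ)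
    (ha : a ≠ 0) (hb : b ≠ 0) (ha' : a' ≠ 0) (hb' : b' ≠ 0) :
    sMean (recipIndex ⊤ (σ + τ)) c d (a * a') (b * b') ≤
      sMean (recipIndex ⊤ σ) c d a b * sMean (recipIndex ⊤ τ) c d a' b' := by
  rcases hσ.eq_or_lt with rfl | hσ
  · rw [zero_add, recipIndex_zero]
    exact sMean_top_mul_pos hτ ha hb ha' hb'
  rcases hτ.eq_or_lt with rfl | hτ
  · rw [add_zero, recipIndex_zero, mul_comm a, mul_comm b, mul_comm (sMean _ _ _ _ _)]
    exact sMean_top_mul_pos hσ.le ha' hb' ha hb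
  have hst : 0 < σ + τ := by positivity
  rw [sMean_recipIndex hst.ne' (mul_ne_zero ha ha') (mul_ne_zero hb hb'),
    sMean_recipIndex hσ.ne' ha hb, sMean_recipIndex hτ.ne' ha' hb']
  have hθ0 : 0 < σ / (σ + τ) := by positivity
  have hθ1 : σ / (σ + τ) < 1 := by rw [div_lt_one hst]; linarith
  have e : ∀ x y : ℝ≥0∞, (x * y) ^ (σ + τ)⁻¹ =
      (x ^ σ⁻¹) ^ (σ / (σ + τ)) * (y ^ τ⁻¹) ^ (1 - σ / (σ + τ)) := by
    intro x y
    rw [ENNReal.mul_rpow_of_nonneg _ _ (by positivity), ← ENNReal.rpow_mul, ← ENNReal.rpow_mul]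
    congr 2
    · field_simp
    · field_simp; ring
  rw [e, e]
  calc _ ≤ ((ENNReal.ofReal c * a ^ σ⁻¹ + ENNReal.ofReal d * b ^ σ⁻¹) ^ (σ / (σ + τ)) *
        (ENNReal.ofReal c * a' ^ τ⁻¹ + ENNReal.ofReal d * b' ^ τ⁻¹) ^ (1 - σ / (σ + τ)))
          ^ (σ + τ) := by
        gcongr
        exact weighted_holder hθ0 hθ1
    _ = _ := by
      rw [ENNReal.mul_rpow_of_nonneg _ _ hst.le, ← ENNReal.rpow_mul, ← ENNReal.rpow_mul]
      congr 2
      · field_simp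
      · field_simp; ring

/-- Hölder's inequality for means of indices `1 / σ > 0` and `1 / τ < 0`, with `1 / σ ≥ - 1 / τ`. -/
theorem sMean_mul_le_neg {σ τ : ℝ} (hcd : 0 < c + d)
    (hσ : 0 ≤ σ) (hτ : τ < 0) (hστ : σ + τ ≤ 0)
    (ha : a ≠ 0) (hb : b ≠ 0) (ha' : a' ≠ 0) (hb' : b' ≠ 0)
    (hat : a ≠ ∞) (hbt : b ≠ ∞) (hat' : a' ≠ ∞) (hbt' : b' ≠ ∞) :
    sMean (recipIndex ⊥ (σ + τ)) c d (a * a') (b * b') ≤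
      sMean (recipIndex ⊤ σ) c d a b * sMean (recipIndex ⊥ τ) c d a' b' := by
  have hA := mul_ne_zero ha ha'
  have hB := mul_ne_zero hb hb'
  have mulr : ∀ {x y : ℝ≥0∞} (r : ℝ), x ≠ 0 → x ≠ ∞ → (x * y) ^ r = x ^ r * y ^ r := fun r h h' =>
    (ENNReal.mul_rpow_eq_ite _ _ r).trans (by simp [h, h'])
  rw [sMean_recipIndex hτ.ne ha' hb']
  rcases hσ.eq_or_lt with rfl | hσ
  · rw [zero_add, recipIndex_zero, sMean_recipIndex hτ.ne hA hB, sMean_top ha hb]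
    have hm : max a b ≠ 0 := by rcases max_choice a b with h | h <;> rw [h] <;> assumption
    have hm' : max a b ≠ ∞ := by rcases max_choice a b with h | h <;> rw [h] <;> assumption
    calc _ ≤ ((max a b) ^ τ⁻¹ *
            (ENNReal.ofReal c * a' ^ τ⁻¹ + ENNReal.ofReal d * b' ^ τ⁻¹)) ^ τ :=
          ENNReal.rpow_le_rpow_of_nonpos' hτ.le (le_max_rpow_mul (inv_nonpos.2 hτ.le) hm hm'
            (le_max_left _ _) (le_max_right _ _))
      _ = _ := by
        rw [mulr _ (rpow_ne_zero_of_ne hm hm' _) (ENNReal.rpow_ne_top_of_ne_zero hm hm'),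
          ENNReal.rpow_inv_rpow hτ.ne]
  rw [sMean_recipIndex hσ.ne' ha hb]
  set A := ENNReal.ofReal c * a ^ σ⁻¹ + ENNReal.ofReal d * b ^ σ⁻¹ with hAdef
  set B := ENNReal.ofReal c * a' ^ τ⁻¹ + ENNReal.ofReal d * b' ^ τ⁻¹ with hBdef
  have hA0 : A ≠ 0 := weighted_sum_ne_zero hcd (rpow_ne_zero_of_ne ha hat _)
    (rpow_ne_zero_of_ne hb hbt _)
  have hAt : A ≠ ∞ := weighted_sum_ne_top (ENNReal.rpow_ne_top_of_ne_zero ha hat)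
    (ENNReal.rpow_ne_top_of_ne_zero hb hbt)
  rcases hστ.eq_or_lt with hστ | hστ
  · obtain rfl : τ = -σ := by linarith
    rw [hστ, recipIndex_zero, sMean_bot hA hB]
    set m := min (a * a') (b * b') with hm
    have hm0 : m ≠ 0 := by rcases min_choice (a * a') (b * b') with h | h <;> rw [hm, h] <;> assumption
    have hmt : m ≠ ∞ := ne_top_of_le_ne_top (ENNReal.mul_ne_top hat hat') (min_le_left _ _)
    -- When the reciprocals cancel, the left mean is the minimum `m`. From `m ≤ x * y` comes a
    -- termwise comparison of `B` with a multiple of `A`, and raising to the negative power `-σ`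
    -- reverses it.
    have hle : ∀ x y : ℝ≥0∞, y ≠ 0 → y ≠ ∞ → m ≤ x * y → y ^ (-σ)⁻¹ ≤ m ^ (-σ)⁻¹ * x ^ σ⁻¹ := by
      intro x y h0 ht h
      rw [inv_neg, ENNReal.rpow_neg, ENNReal.rpow_neg]
      rw [← ENNReal.div_eq_inv_mul, ENNReal.le_div_iff_mul_le
        (Or.inl (rpow_ne_zero_of_ne hm0 hmt _)) (Or.inl (ENNReal.rpow_ne_top_of_ne_zero hm0 hmt)),
        mul_comm, ← div_eq_mul_inv]
      rw [ENNReal.div_le_iff_le_mul (Or.inl (rpow_ne_zero_of_ne h0 ht _))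
        (Or.inl (ENNReal.rpow_ne_top_of_ne_zero h0 ht)),
        ← ENNReal.mul_rpow_of_nonneg _ _ (by positivity)]
      exact ENNReal.rpow_le_rpow h (by positivity)
    have hBA : B ≤ m ^ (-σ)⁻¹ * A := by
      calc B ≤ ENNReal.ofReal c * (m ^ (-σ)⁻¹ * a ^ σ⁻¹) +
            ENNReal.ofReal d * (m ^ (-σ)⁻¹ * b ^ σ⁻¹) := by
            rw [hBdef]
            gcongr
            · exact hle _ _ ha' hat' (min_le_left _ _)
            · exact hle _ _ hb' hbt' (min_le_right _ _)
        _ = _ := by rw [hAdef]; ring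
    calc m = A ^ σ * (m ^ (-σ)⁻¹ * A) ^ (-σ) := by
          rw [mulr _ (rpow_ne_zero_of_ne hm0 hmt _) (ENNReal.rpow_ne_top_of_ne_zero hm0 hmt),
            ENNReal.rpow_inv_rpow hτ.ne, mul_left_comm, ← ENNReal.rpow_add _ _ hA0 hAt]
          simp
      _ ≤ A ^ σ * B ^ (-σ) := by
        exact mul_le_mul_right (ENNReal.rpow_le_rpow_of_nonpos' hτ.le hBA) _
  · rw [sMean_recipIndex hστ.ne hA hB]
    set G := ENNReal.ofReal c * (a * a') ^ (σ + τ)⁻¹ + ENNReal.ofReal d * (b * b') ^ (σ + τ)⁻¹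
      with hG
    have hat2 := ENNReal.mul_ne_top hat hat'
    have hbt2 := ENNReal.mul_ne_top hbt hbt'
    have hG0 : G ≠ 0 := weighted_sum_ne_zero hcd (rpow_ne_zero_of_ne hA hat2 _)
      (rpow_ne_zero_of_ne hB hbt2 _)
    have hGt : G ≠ ∞ := weighted_sum_ne_top (ENNReal.rpow_ne_top_of_ne_zero hA hat2)
      (ENNReal.rpow_ne_top_of_ne_zero hB hbt2)
    have hθ0 : 0 < (σ + τ) / τ := div_pos_of_neg_of_neg hστ hτ
    have hθ1 : (σ + τ) / τ < 1 := by
      rw [div_lt_one_of_neg hτ]; linarith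
    -- Reverse Hölder from ordinary Hölder: `y` is recovered from `x * y` and `x`, with weight `θ =
    -- (σ + τ) / τ ∈ (0, 1)`. This bounds `B` by powers of `G` and `A`; the power `τ < 0` then turns
    -- the inequality around.
    have e : ∀ x y : ℝ≥0∞, x ≠ 0 → x ≠ ∞ → y ^ τ⁻¹ =
        ((x * y) ^ (σ + τ)⁻¹) ^ ((σ + τ) / τ) * (x ^ σ⁻¹) ^ (1 - (σ + τ) / τ) := by
      intro x y h h'
      have e1 : (σ + τ)⁻¹ * ((σ + τ) / τ) = τ⁻¹ := by field_simp [hστ.ne, hτ.ne]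
      have e2 : σ⁻¹ * (1 - (σ + τ) / τ) = -τ⁻¹ := by field_simp [hσ.ne', hτ.ne]; ring
      rw [← ENNReal.rpow_mul, ← ENNReal.rpow_mul, e1, e2, mulr _ h h', mul_right_comm,
        ← ENNReal.rpow_add _ _ h h']
      simp
    have hBG : B ≤ G ^ ((σ + τ) / τ) * A ^ (1 - (σ + τ) / τ) := by
      rw [hBdef, e a a' ha hat, e b b' hb hbt]
      exact weighted_holder hθ0 hθ1
    calc G ^ (σ + τ) = A ^ σ * (G ^ ((σ + τ) / τ) * A ^ (1 - (σ + τ) / τ)) ^ τ := by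
          have e1 : (σ + τ) / τ * τ = σ + τ := div_mul_cancel₀ _ hτ.ne
          have e2 : (1 - (σ + τ) / τ) * τ = -σ := by rw [sub_mul, e1]; ring
          rw [mulr _ (rpow_ne_zero_of_ne hG0 hGt _) (ENNReal.rpow_ne_top_of_ne_zero hG0 hGt),
            ← ENNReal.rpow_mul, ← ENNReal.rpow_mul, e1, e2, mul_left_comm,
            ← ENNReal.rpow_add _ _ hA0 hAt]
          simp
      _ ≤ A ^ σ * B ^ τ := by
        exact mul_le_mul_right (ENNReal.rpow_le_rpow_of_nonpos' hτ.le hBG) _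

theorem sMean_zero_le_pos {τ : ℝ} (hc : 0 ≤ c) (hd : 0 ≤ d) (hcd : c + d = 1) (hτ : 0 ≤ τ)
    (ha : a ≠ 0) (hb : b ≠ 0) (hat : a ≠ ∞) (hbt : b ≠ ∞) :
    sMean 0 c d a b ≤ sMean (recipIndex ⊤ τ) c d a b := by
  rw [sMean_zero ha hb]
  rcases hτ.eq_or_lt with rfl | hτ
  · rw [recipIndex_zero, sMean_top ha hb]
    calc a ^ c * b ^ d ≤ (max a b) ^ c * (max a b) ^ d := by
          gcongr
          · exact le_max_left _ _
          · exact le_max_right _ _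
      _ = max a b := by rw [← ENNReal.rpow_add_of_nonneg _ _ hc hd, hcd, ENNReal.rpow_one]
  · rw [sMean_recipIndex hτ.ne' ha hb]
    have key : a ^ (τ⁻¹ * c) * b ^ (τ⁻¹ * d) ≤
        ENNReal.ofReal c * a ^ τ⁻¹ + ENNReal.ofReal d * b ^ τ⁻¹ := by
      lift c to ℝ≥0 using hc
      lift d to ℝ≥0 using hd
      lift a to ℝ≥0 using hat
      lift b to ℝ≥0 using hbt
      have hcd' : c + d = 1 := by exact_mod_cast hcd
      have := NNReal.geom_mean_le_arith_mean2_weighted c d (a ^ τ⁻¹) (b ^ τ⁻¹) hcd'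
      rw [← NNReal.rpow_mul, ← NNReal.rpow_mul] at this
      have ha0 : a ≠ 0 := by simpa using ha
      have hb0 : b ≠ 0 := by simpa using hb
      simp only [ENNReal.ofReal_coe_nnreal]
      rw [← ENNReal.coe_rpow_of_ne_zero ha0, ← ENNReal.coe_rpow_of_ne_zero hb0,
        ← ENNReal.coe_rpow_of_ne_zero ha0, ← ENNReal.coe_rpow_of_ne_zero hb0]
      exact_mod_cast this
    calc a ^ c * b ^ d = (a ^ (τ⁻¹ * c) * b ^ (τ⁻¹ * d)) ^ τ := by
          rw [ENNReal.mul_rpow_of_nonneg _ _ hτ.le, ← ENNReal.rpow_mul, ← ENNReal.rpow_mul]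
          congr 2 <;> field_simp
      _ ≤ _ := by gcongr

theorem sMean_zero_mul {c d : ℝ} (hc : 0 ≤ c) (hd : 0 ≤ d)
    (ha : a ≠ 0) (hb : b ≠ 0) (ha' : a' ≠ 0) (hb' : b' ≠ 0) :
    sMean 0 c d (a * a') (b * b') = sMean 0 c d a b * sMean 0 c d a' b' := by
  rw [sMean_zero ha hb, sMean_zero ha' hb', sMean_zero (mul_ne_zero ha ha') (mul_ne_zero hb hb'),
    ENNReal.mul_rpow_of_nonneg _ _ hc, ENNReal.mul_rpow_of_nonneg _ _ hd, mul_mul_mul_comm]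

end

/-! ### A linear Brunn-Minkowski inequality and its functional form -/

theorem lintegral_eq_lintegral_measure_ofReal_lt {α : Type*} [MeasurableSpace α]
    (μ : Measure α) {u : α → ℝ≥0∞} (hu : Measurable u)
    (hu1 : ∀ x, u x ≠ ∞) :
    ∫⁻ x, u x ∂μ = ∫⁻ t in Set.Ioi (0 : ℝ), μ {x | ENNReal.ofReal t < u x} := by
  have h := lintegral_eq_lintegral_meas_lt μ (f := fun x => (u x).toReal)
    (ae_of_all _ fun x => ENNReal.toReal_nonneg) hu.ennreal_toReal.aemeasurable
  simp only [ENNReal.ofReal_toReal (hu1 _)] at h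
  rw [h]
  refine setLIntegral_congr_fun measurableSet_Ioi fun t ht => ?_
  simp only [ENNReal.ofReal_lt_iff_lt_toReal (le_of_lt ht) (hu1 _)]

theorem measure_eq_iSup_nonempty_isCompact {E : Type*} [NormedAddCommGroup E] [NormedSpace ℝ E]
    [FiniteDimensional ℝ E] [MeasurableSpace E] [BorelSpace E] (μ : Measure E) [μ.IsAddHaarMeasure]
    {A : Set E} (hA : MeasurableSet A) :
    μ A = ⨆ K : {K : Set E // K ⊆ A ∧ IsCompact K ∧ K.Nonempty}, μ K := by
  apply le_antisymm
  · rcases eq_or_ne (μ A) 0 with h | h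
    · simp [h]
    · refine le_of_forall_lt fun r hr => ?_
      obtain ⟨K, hKA, hK, hrK⟩ := hA.exists_lt_isCompact hr
      refine hrK.trans_le (le_iSup (fun K : {K : Set E // K ⊆ A ∧ IsCompact K ∧ K.Nonempty} =>
        μ K) ⟨K, hKA, hK, ?_⟩)
      exact nonempty_of_measure_ne_zero (ne_bot_of_gt hrK)
  · exact iSup_le fun K => measure_mono K.2.1

section BrunnMinkowski

variable {E : Type*} [NormedAddCommGroup E] [NormedSpace ℝ E] [FiniteDimensional ℝ E]
  [MeasurableSpace E] [BorelSpace E] (μ : Measure E) [μ.IsAddHaarMeasure]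

open Module Pointwise

theorem measure_level_set_eq_zero {φ : E →L[ℝ] ℝ} (hφ : φ ≠ 0) (x₀ : E) :
    μ {x | φ x = φ x₀} = 0 := by
  have h1 : μ ((φ : E →ₗ[ℝ] ℝ).ker : Set E) = 0 := by
    apply Measure.addHaar_submodule
    intro h
    apply hφ
    ext x
    have : x ∈ (φ : E →ₗ[ℝ] ℝ).ker := h ▸ Submodule.mem_top
    simpa using this
  have h2 : {x | φ x = φ x₀} = (fun x => x - x₀) ⁻¹' ((φ : E →ₗ[ℝ] ℝ).ker : Set E) := by
    ext x
    simp [sub_eq_zero]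
  simp only [h2, sub_eq_add_neg]
  rw [measure_preimage_add_right, h1]

variable [Nontrivial E]

/-- With `a` maximising a functional `φ` on `K` and `b` minimising it on `L`, the translates `c • K
+ d • b` and `c • a + d • L` both lie in `S`, on opposite sides of the hyperplane `φ = φ (c • a + d
• b)`. They overlap in a null set, so their measures add. -/
theorem measure_combination_ge_of_isCompact {c d : ℝ} (hc : 0 ≤ c) (hd : 0 ≤ d) {K L S : Set E}
    (hK : IsCompact K) (hL : IsCompact L) (hK0 : K.Nonempty) (hL0 : L.Nonempty)
    (hS : ∀ x ∈ K, ∀ y ∈ L, c • x + d • y ∈ S) :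
    ENNReal.ofReal (c ^ finrank ℝ E) * μ K + ENNReal.ofReal (d ^ finrank ℝ E) * μ L ≤ μ S := by
  obtain ⟨e, he⟩ := exists_ne (0 : E)
  obtain ⟨φ, hφe⟩ := SeparatingDual.exists_ne_zero (R := ℝ) he
  have hφ : φ ≠ 0 := fun h => hφe (by simp [h])
  obtain ⟨a, haK, ha⟩ := hK.exists_isMaxOn hK0 φ.continuous.continuousOn
  obtain ⟨b, hbL, hb⟩ := hL.exists_isMinOn hL0 φ.continuous.continuousOn
  have hX : IsCompact ((fun x => x + d • b) '' (c • K)) :=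
    (hK.smul c).image (by fun_prop)
  have hY : IsCompact ((fun x => c • a + x) '' (d • L)) :=
    (hL.smul d).image (by fun_prop)
  have hdisj : AEDisjoint μ ((fun x => x + d • b) '' (c • K)) ((fun x => c • a + x) '' (d • L)) := by
    refine measure_mono_null ?_ (measure_level_set_eq_zero μ hφ (c • a + d • b))
    rintro z ⟨⟨_, ⟨x, hx, rfl⟩, rfl⟩, ⟨_, ⟨y, hy, rfl⟩, h⟩⟩
    have h1 : φ x ≤ φ a := ha hx
    have h2 : φ b ≤ φ y := hb hy
    have h3 := congrArg φ h
    simp only [map_add, map_smul, smul_eq_mul, Set.mem_ofPred_eq] at h3 ⊢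
    nlinarith [mul_le_mul_of_nonneg_left h1 hc, mul_le_mul_of_nonneg_left h2 hd]
  calc _ = μ ((fun x => x + d • b) '' (c • K)) + μ ((fun x => c • a + x) '' (d • L)) := by
        rw [Set.image_add_right, measure_preimage_add_right, Set.image_add_left,
          measure_preimage_add, Measure.addHaar_smul, Measure.addHaar_smul,
          abs_of_nonneg (pow_nonneg hc _), abs_of_nonneg (pow_nonneg hd _)]
    _ = μ ((fun x => x + d • b) '' (c • K) ∪ (fun x => c • a + x) '' (d • L)) :=
        (measure_union₀ hY.measurableSet.nullMeasurableSet hdisj).symm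
    _ ≤ μ S := by
      apply measure_mono
      rintro z (⟨_, ⟨x, hx, rfl⟩, rfl⟩ | ⟨_, ⟨y, hy, rfl⟩, rfl⟩)
      · exact hS x hx b hbL
      · exact hS a haK y hy

/-- A weak form of the Brunn-Minkowski inequality, linear in the measures. -/
theorem measure_combination_ge {c d : ℝ} (hc : 0 ≤ c) (hd : 0 ≤ d) {A B S : Set E}
    (hA : MeasurableSet A) (hB : MeasurableSet B) (hA0 : A.Nonempty) (hB0 : B.Nonempty)
    (hS : ∀ x ∈ A, ∀ y ∈ B, c • x + d • y ∈ S) :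
    ENNReal.ofReal (c ^ finrank ℝ E) * μ A + ENNReal.ofReal (d ^ finrank ℝ E) * μ B ≤ μ S := by
  have ne : ∀ {A : Set E}, A.Nonempty → Nonempty {K : Set E // K ⊆ A ∧ IsCompact K ∧ K.Nonempty} :=
    fun ⟨a, ha⟩ => ⟨{a}, by simpa using ha, isCompact_singleton, Set.singleton_nonempty a⟩
  have := ne hA0
  have := ne hB0
  rw [measure_eq_iSup_nonempty_isCompact μ hA, measure_eq_iSup_nonempty_isCompact μ hB,
    ENNReal.mul_iSup, ENNReal.mul_iSup]
  exact ENNReal.iSup_add_iSup_le fun K L =>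
    measure_combination_ge_of_isCompact μ hc hd K.2.2.1 L.2.2.1 K.2.2.2 L.2.2.2
      fun x hx y hy => hS x (K.2.1 hx) y (L.2.1 hy)

/-- Layer-cake argument: for `t < 1` the superlevel sets of `u` and `v` are both nonempty because
the suprema are equal, so the set inequality applies; for `t ≥ 1` they are empty. -/
theorem lintegral_combination_ge_of_iSup_eq_one {c d : ℝ} (hc : 0 ≤ c) (hd : 0 ≤ d)
    {u v w : E → ℝ≥0∞} (hu : Measurable u) (hv : Measurable v) (hw : Measurable w)
    (hu1 : ⨆ x, u x = 1) (hv1 : ⨆ x, v x = 1)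
    (h : ∀ x y, min (u x) (v y) ≤ w (c • x + d • y)) :
    ENNReal.ofReal (c ^ finrank ℝ E) * ∫⁻ x, u x ∂μ +
      ENNReal.ofReal (d ^ finrank ℝ E) * ∫⁻ x, v x ∂μ ≤ ∫⁻ x, w x ∂μ := by
  have hule : ∀ x, u x ≤ 1 := fun x => hu1 ▸ le_iSup u x
  have hvle : ∀ x, v x ≤ 1 := fun x => hv1 ▸ le_iSup v x
  have hw' : Measurable fun x => min (w x) 1 := hw.min measurable_const
  refine le_trans ?_ (lintegral_mono (f := fun x => min (w x) 1) fun x => min_le_left _ _)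
  rw [lintegral_eq_lintegral_measure_ofReal_lt μ hu
      fun x => ne_top_of_le_ne_top ENNReal.one_ne_top (hule x),
    lintegral_eq_lintegral_measure_ofReal_lt μ hv
      fun x => ne_top_of_le_ne_top ENNReal.one_ne_top (hvle x),
    lintegral_eq_lintegral_measure_ofReal_lt μ hw'
      fun x => ne_top_of_le_ne_top ENNReal.one_ne_top (min_le_right _ _)]
  refine (add_le_add (lintegral_const_mul_le _ _) (lintegral_const_mul_le _ _)).trans ?_
  refine (le_lintegral_add _ _).trans ?_
  refine setLIntegral_mono' measurableSet_Ioi fun t ht => ?_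
  rcases lt_or_ge t 1 with ht1 | ht1
  · have ht1' : ENNReal.ofReal t < 1 := by simpa using ht1
    apply measure_combination_ge μ hc hd (measurableSet_lt measurable_const hu)
      (measurableSet_lt measurable_const hv)
    · exact lt_iSup_iff.1 (hu1.symm ▸ ht1')
    · exact lt_iSup_iff.1 (hv1.symm ▸ ht1')
    · intro x hx y hy
      exact lt_min ((lt_min hx hy).trans_le (h x y)) ht1'
  · have ht1' : 1 ≤ ENNReal.ofReal t := by simpa using ht1
    have e : ∀ {f : E → ℝ≥0∞}, (∀ x, f x ≤ 1) → {x | ENNReal.ofReal t < f x} = ∅ := fun hf =>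
      Set.eq_empty_of_forall_notMem fun x hx => absurd ((hf x).trans ht1') (not_le.2 hx)
    simp [e hule, e hvle]

/-- Normalise `u`, `v`, `w` by `U`, `V` and `M = sMean γ c d U V`. If `m = min (u x / U) (v y / V)`,
homogeneity gives `m * M = sMean γ c d (m * U) (m * V) ≤ sMean γ c d (u x) (v y)`, so the quotients
satisfy the hypothesis with a minimum. -/
theorem lintegral_combination_ge {γ : EReal} {c d : ℝ} (hc : 0 ≤ c) (hd : 0 ≤ d) (hcd : 0 < c + d)
    (hγ : γ = 0 → c + d = 1)
    {u v w : E → ℝ≥0∞} (hu : Measurable u) (hv : Measurable v) (hw : Measurable w)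
    (hu0 : ⨆ x, u x ≠ 0) (hv0 : ⨆ x, v x ≠ 0) (hut : ⨆ x, u x ≠ ∞) (hvt : ⨆ x, v x ≠ ∞)
    (h : ∀ x y, sMean γ c d (u x) (v y) ≤ w (c • x + d • y)) :
    sMean γ c d (⨆ x, u x) (⨆ x, v x) *
      (ENNReal.ofReal (c ^ finrank ℝ E) * ((∫⁻ x, u x ∂μ) / ⨆ x, u x) +
      ENNReal.ofReal (d ^ finrank ℝ E) * ((∫⁻ x, v x ∂μ) / ⨆ x, v x)) ≤ ∫⁻ x, w x ∂μ := by
  set U := ⨆ x, u x with hU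
  set V := ⨆ x, v x with hV
  obtain ⟨hM0, hMt⟩ := sMean_ne_zero_ne_top (s := γ) hcd hu0 hut hv0 hvt
  set M := sMean γ c d U V
  have hdiv : ∀ {f : E → ℝ≥0∞} {F : ℝ≥0∞}, ⨆ x, f x = F → F ≠ 0 → F ≠ ∞ → ⨆ x, f x / F = 1 := by
    intro f F hF h0 ht
    rw [← ENNReal.iSup_div, hF, ENNReal.div_self h0 ht]
  have key := lintegral_combination_ge_of_iSup_eq_one μ hc hd (hu.div_const U) (hv.div_const V)
    (hw.div_const M) (hdiv hU.symm hu0 hut) (hdiv hV.symm hv0 hvt) (fun x y => by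
      rw [ENNReal.le_div_iff_mul_le (Or.inl hM0) (Or.inl hMt)]
      refine le_trans ?_ (h x y)
      set m := min (u x / U) (v y / V) with hm
      rcases eq_or_ne m 0 with h0 | h0
      · simp [h0]
      have hmu : m ≤ u x / U := min_le_left _ _
      have hmv : m ≤ v y / V := min_le_right _ _
      have hmt : m ≠ ∞ := ne_top_of_le_ne_top
        (ENNReal.div_ne_top (ne_top_of_le_ne_top hut (le_iSup u x)) hu0) hmu
      rw [← sMean_mul_left hc hd hγ h0 hmt hu0 hv0]
      exact sMean_mono hc hd
        ((ENNReal.le_div_iff_mul_le (Or.inl hu0) (Or.inl hut)).1 hmu)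
        ((ENNReal.le_div_iff_mul_le (Or.inl hv0) (Or.inl hvt)).1 hmv))
  simp only [div_eq_mul_inv] at key ⊢
  rw [lintegral_mul_const _ hu, lintegral_mul_const _ hv, lintegral_mul_const _ hw,
    ← div_eq_mul_inv _ M, ENNReal.le_div_iff_mul_le (Or.inl hM0) (Or.inl hMt)] at key
  rw [mul_comm]
  exact key

end BrunnMinkowski

theorem exists_bounded_tendsto_lintegral {α : Type*} [MeasurableSpace α] (μ : Measure α)
    [SigmaFinite μ] {u : α → ℝ≥0∞} (hu : Measurable u) :
    ∃ f : ℕ → α → ℝ≥0∞, (∀ k, Measurable (f k)) ∧ (∀ k x, f k x ≤ u x) ∧ (∀ k x, f k x ≤ k) ∧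
      (∀ k, ∫⁻ x, f k x ∂μ ≠ ∞) ∧
      Tendsto (fun k => ∫⁻ x, f k x ∂μ) atTop (𝓝 (∫⁻ x, u x ∂μ)) := by
  have hm : ∀ k, Measurable ((spanningSets μ k).indicator fun x => min (u x) k) := fun k =>
    (hu.min measurable_const).indicator (measurableSet_spanningSets μ k)
  have hmono : ∀ x, Monotone fun k => (spanningSets μ k).indicator (fun x => min (u x) k) x := by
    intro x k l hkl
    refine (Set.indicator_le_indicator_of_subset (monotone_spanningSets μ hkl)
      (fun _ => zero_le) x).trans (Set.indicator_le_indicator ?_)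
    gcongr
  have hle : ∀ k x, (spanningSets μ k).indicator (fun x => min (u x) k) x ≤ k := fun k x =>
    (Set.indicator_le_self' (fun _ _ => zero_le) x).trans (min_le_right _ _)
  refine ⟨fun k => (spanningSets μ k).indicator fun x => min (u x) k, hm, fun k x => ?_, hle,
    fun k => ?_, ?_⟩
  · exact (Set.indicator_le_self' (fun _ _ => zero_le) x).trans (min_le_left _ _)
  · rw [lintegral_indicator (measurableSet_spanningSets μ k)]
    refine ne_top_of_le_ne_top ?_ (lintegral_mono (g := fun _ => (k : ℝ≥0∞)) fun x => min_le_right _ _)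
    rw [setLIntegral_const]
    exact ENNReal.mul_ne_top (by simp) (measure_spanningSets_lt_top μ k).ne
  · refine lintegral_tendsto_of_tendsto_of_monotone (fun k => (hm k).aemeasurable)
      (ae_of_all _ hmono) (ae_of_all _ fun x => ?_)
    have h1 : Tendsto (fun k : ℕ => min (u x) k) atTop (𝓝 (u x)) := by
      simpa using (tendsto_const_nhds (x := u x)).min ENNReal.tendsto_nat_nhds_top
    refine h1.congr' ?_
    filter_upwards [eventually_ge_atTop (spanningSetsIndex μ x)] with k hk
    rw [Set.indicator_of_mem (monotone_spanningSets μ hk (mem_spanningSetsIndex μ x))]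

/-! ### The Borell-Brascamp-Lieb inequality -/

section BorellBrascampLieb

open Module

/-- The abstract `Φ` serves two conclusions: a mean in dimension one, and a weighted minimum in
dimension `n`. Truncation makes suprema and integrals finite, `hstep` is applied with `I`, `J` the
integrals divided by the suprema, and continuity of `Φ` removes the truncation. -/
theorem le_lintegral_of_sMean_le {E : Type*} [NormedAddCommGroup E] [NormedSpace ℝ E]
    [FiniteDimensional ℝ E] [Nontrivial E] [MeasurableSpace E] [BorelSpace E] (μ : Measure E)
    [μ.IsAddHaarMeasure] {γ : EReal} {c d : ℝ} (hc : 0 ≤ c) (hd : 0 ≤ d) (hcd : 0 < c + d)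
    (hγ : γ = 0 → c + d = 1) {Φ : ℝ≥0∞ → ℝ≥0∞ → ℝ≥0∞}
    (hΦ0 : ∀ a b, a = 0 ∨ b = 0 → Φ a b = 0)
    (hΦ : ∀ {a b : ℝ≥0∞}, a ≠ 0 → b ≠ 0 → ∀ {u v : ℕ → ℝ≥0∞}, Tendsto u atTop (𝓝 a) →
      Tendsto v atTop (𝓝 b) → Tendsto (fun k => Φ (u k) (v k)) atTop (𝓝 (Φ a b)))
    (hstep : ∀ U V I J : ℝ≥0∞, U ≠ 0 → V ≠ 0 → I ≠ 0 → J ≠ 0 → U ≠ ∞ → V ≠ ∞ → I ≠ ∞ → J ≠ ∞ →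
      Φ (U * I) (V * J) ≤ sMean γ c d U V *
        (ENNReal.ofReal (c ^ finrank ℝ E) * I + ENNReal.ofReal (d ^ finrank ℝ E) * J))
    {u v w : E → ℝ≥0∞} (hu : Measurable u) (hv : Measurable v) (hw : Measurable w)
    (h : ∀ x y, sMean γ c d (u x) (v y) ≤ w (c • x + d • y)) :
    Φ (∫⁻ x, u x ∂μ) (∫⁻ x, v x ∂μ) ≤ ∫⁻ x, w x ∂μ := by
  by_cases h0 : (∫⁻ x, u x ∂μ) = 0 ∨ (∫⁻ x, v x ∂μ) = 0
  · simp [hΦ0 _ _ h0]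
  push Not at h0
  obtain ⟨f, hfm, hfu, hfk, hft, hf⟩ := exists_bounded_tendsto_lintegral μ hu
  obtain ⟨g, hgm, hgv, hgk, hgt, hg⟩ := exists_bounded_tendsto_lintegral μ hv
  refine le_of_tendsto' (hΦ h0.1 h0.2 hf hg) fun k => ?_
  by_cases hk : (∫⁻ x, f k x ∂μ) = 0 ∨ (∫⁻ x, g k x ∂μ) = 0
  · simp [hΦ0 _ _ hk]
  push Not at hk
  have ne0 : ∀ {F : E → ℝ≥0∞}, (∫⁻ x, F x ∂μ) ≠ 0 → ⨆ x, F x ≠ 0 := fun {F} h1 h2 => by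
    have : ∀ x, F x = 0 := by simpa using h2
    simp [this] at h1
  have net : ∀ {F : E → ℝ≥0∞}, (∀ x, F x ≤ k) → ⨆ x, F x ≠ ∞ := fun h1 =>
    ne_top_of_le_ne_top (ENNReal.natCast_ne_top k) (iSup_le h1)
  have hf0 := ne0 hk.1
  have hg0 := ne0 hk.2
  have hft' := net (hfk k)
  have hgt' := net (hgk k)
  have key := lintegral_combination_ge μ hc hd hcd hγ (hfm k) (hgm k) hw hf0 hg0 hft' hgt'
    fun x y => (sMean_mono hc hd (hfu k x) (hgv k y)).trans (h x y)
  refine le_trans ?_ key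
  have := hstep _ _ _ _ hf0 hg0 (ENNReal.div_ne_zero.2 ⟨hk.1, hft'⟩)
    (ENNReal.div_ne_zero.2 ⟨hk.2, hgt'⟩) hft' hgt' (ENNReal.div_ne_top (hft k) hf0)
    (ENNReal.div_ne_top (hgt k) hg0)
  rwa [ENNReal.mul_div_cancel hf0 hft', ENNReal.mul_div_cancel hg0 hgt'] at this

/-- The condition under which the one-dimensional Borell-Brascamp-Lieb inequality turns a mean of
index `γ` into a mean of index `γ'`. -/
def MeanStep (c d : ℝ) (γ γ' : EReal) : Prop :=
  ∀ U V I J : ℝ≥0∞, U ≠ 0 → V ≠ 0 → I ≠ 0 → J ≠ 0 → U ≠ ∞ → V ≠ ∞ → I ≠ ∞ → J ≠ ∞ →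
    sMean γ' c d (U * I) (V * J) ≤
      sMean γ c d U V * (ENNReal.ofReal c * I + ENNReal.ofReal d * J)

theorem sMean_lintegral_le_real {γ γ' : EReal} {c d : ℝ} (hc : 0 ≤ c) (hd : 0 ≤ d)
    (hcd : 0 < c + d) (hγ : γ = 0 → c + d = 1) (hstep : MeanStep c d γ γ')
    {u v w : ℝ → ℝ≥0∞} (hu : Measurable u) (hv : Measurable v) (hw : Measurable w)
    (h : ∀ x y, sMean γ c d (u x) (v y) ≤ w (c * x + d * y)) :
    sMean γ' c d (∫⁻ x, u x) (∫⁻ x, v x) ≤ ∫⁻ x, w x :=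
  le_lintegral_of_sMean_le volume hc hd hcd hγ (Φ := sMean γ' c d)
    (fun _ _ => sMean_of_eq_zero) (fun ha hb _ _ => tendsto_sMean hc hd ha hb)
    (by simpa only [MeanStep, finrank_self, pow_one] using hstep) hu hv hw h

theorem measurable_lintegral_cons {n : ℕ} {u : (Fin (n + 1) → ℝ) → ℝ≥0∞} (hu : Measurable u) :
    Measurable fun x : Fin n → ℝ => ∫⁻ r : ℝ, u (Fin.cons r x) := by
  have h : Measurable fun z : ℝ × (Fin n → ℝ) => u (Fin.cons z.1 z.2) := by
    refine hu.comp (measurable_pi_iff.2 fun i => ?_)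
    refine Fin.cases ?_ (fun j => ?_) i
    · simpa using measurable_fst
    · simpa [Function.comp_def] using (measurable_pi_apply j).comp measurable_snd
  exact h.lintegral_prod_left'

theorem lintegral_eq_lintegral_lintegral_cons {n : ℕ} {u : (Fin (n + 1) → ℝ) → ℝ≥0∞}
    (hu : Measurable u) :
    ∫⁻ x, u x = ∫⁻ x : Fin n → ℝ, ∫⁻ r : ℝ, u (Fin.cons r x) := by
  have e := (volume_preserving_piFinSuccAbove (fun _ : Fin (n + 1) => ℝ) 0).symm
  rw [← e.lintegral_comp hu, Measure.volume_eq_prod, lintegral_prod_symm]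
  · simp [MeasurableEquiv.piFinSuccAbove, Fin.insertNthEquiv]
  · exact (hu.comp (MeasurableEquiv.measurable _)).aemeasurable

theorem sMean_lintegral_cons_le {n : ℕ} {γ γ' : EReal} {c d : ℝ} (hc : 0 ≤ c) (hd : 0 ≤ d)
    (hcd : 0 < c + d) (hγ : γ = 0 → c + d = 1) (hstep : MeanStep c d γ γ')
    {u v w : (Fin (n + 1) → ℝ) → ℝ≥0∞} (hu : Measurable u) (hv : Measurable v) (hw : Measurable w)
    (h : ∀ x y, sMean γ c d (u x) (v y) ≤ w (c • x + d • y)) (x y : Fin n → ℝ) :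
    sMean γ' c d (∫⁻ r : ℝ, u (Fin.cons r x)) (∫⁻ r : ℝ, v (Fin.cons r y)) ≤
      ∫⁻ r : ℝ, w (Fin.cons r (c • x + d • y)) := by
  have hm : ∀ z : Fin n → ℝ, Measurable fun r : ℝ => (Fin.cons r z : Fin (n + 1) → ℝ) := by
    refine fun z => measurable_pi_iff.2 fun i => ?_
    refine Fin.cases ?_ (fun j => ?_) i
    · exact measurable_id
    · simp
  refine sMean_lintegral_le_real hc hd hcd hγ hstep (hu.comp (hm x)) (hv.comp (hm y))
    (hw.comp (hm _)) fun r s => (h _ _).trans (le_of_eq ?_)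
  congr 1
  ext i
  refine Fin.cases ?_ (fun j => ?_) i <;> simp

/-- The **Borell-Brascamp-Lieb inequality** for measurable functions on `ℝⁿ`, in the range where
the integrals are compared by a mean. -/
theorem sMean_lintegral_le {n : ℕ} {γ : ℕ → EReal} {c d : ℝ} (hc : 0 ≤ c) (hd : 0 ≤ d)
    (hcd : 0 < c + d) (hγ : ∀ k, γ k = 0 → c + d = 1)
    (hstep : ∀ k < n, MeanStep c d (γ k) (γ (k + 1)))
    {u v w : (Fin n → ℝ) → ℝ≥0∞} (hu : Measurable u) (hv : Measurable v) (hw : Measurable w)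
    (h : ∀ x y, sMean (γ 0) c d (u x) (v y) ≤ w (c • x + d • y)) :
    sMean (γ n) c d (∫⁻ x, u x) (∫⁻ x, v x) ≤ ∫⁻ x, w x := by
  induction n generalizing γ with
  | zero =>
    have := h default default
    rw [Subsingleton.elim (c • default + d • default) (default : Fin 0 → ℝ)] at this
    simpa only [volume_pi, Measure.pi_of_empty _ (default : Fin 0 → ℝ), lintegral_dirac] using this
  | succ n ih =>
    rw [lintegral_eq_lintegral_lintegral_cons hu, lintegral_eq_lintegral_lintegral_cons hv,
      lintegral_eq_lintegral_lintegral_cons hw]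
    -- Integrating out one coordinate uses up one `MeanStep`; the partial integrals satisfy the
    -- hypothesis with the next index.
    exact ih (γ := fun k => γ (k + 1)) (fun k => hγ _) (fun k hk => hstep _ (by omega))
      (measurable_lintegral_cons hu) (measurable_lintegral_cons hv) (measurable_lintegral_cons hw)
      (sMean_lintegral_cons_le hc hd hcd (hγ 0) (hstep 0 (by omega)) hu hv hw h)

theorem MeanStep.zero {c d : ℝ} (hc : 0 ≤ c) (hd : 0 ≤ d) (hcd : c + d = 1) :
    MeanStep c d 0 0 := by
  intro U V I J hU hV hI hJ _ _ hI' hJ'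
  rw [sMean_zero_mul hc hd hU hV hI hJ, ← sMean_one hI hJ]
  gcongr
  exact sMean_zero_le_pos hc hd hcd zero_le_one hI hJ hI' hJ'

/-- The sum `c * I + d * J` is the mean of reciprocal index 1, so Hölder adds 1 to the reciprocal.
-/
theorem MeanStep.pos {c d ρ : ℝ} (hρ : 0 ≤ ρ) :
    MeanStep c d (recipIndex ⊤ ρ) (recipIndex ⊤ (ρ + 1)) := by
  intro U V I J hU hV hI hJ _ _ _ _
  rw [← sMean_one hI hJ]
  exact sMean_mul_le_pos hρ zero_le_one hU hV hI hJ

theorem MeanStep.neg {c d ρ : ℝ} (hcd : 0 < c + d) (hρ : ρ ≤ -1) :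
    MeanStep c d (recipIndex ⊥ ρ) (recipIndex ⊥ (ρ + 1)) := by
  intro U V I J hU hV hI hJ hU' hV' hI' hJ'
  rw [← sMean_one hI hJ, mul_comm U, mul_comm V, mul_comm (sMean _ _ _ _ _), add_comm ρ]
  exact sMean_mul_le_neg hcd zero_le_one (by linarith) (by linarith) hI hJ hU hV hI' hJ' hU' hV'

/-! ### The Dancs-Uhrin range. -/

/-- For `τ < 0`, let `P` be the weighted sum inside the mean. As `-τ ∈ (0, 1]`, the power `P ^ (-τ)`
is subadditive. The exponent `n + τ` is the one for which each term of the minimum, times its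
summand `(c * U ^ τ⁻¹) ^ (-τ)`, becomes `c ^ n * I` (respectively `d ^ n * J`). -/
theorem min_mul_le_sMean_mul {c d τ : ℝ} (hc : 0 < c) (hd : 0 < d) (hτ : -1 ≤ τ) (hτ0 : τ ≤ 0)
    (n : ℕ) {U V I J : ℝ≥0∞} (hU : U ≠ 0) (hV : V ≠ 0) (hU' : U ≠ ∞) (hV' : V ≠ ∞) :
    min (ENNReal.ofReal c ^ (n + τ) * (U * I)) (ENNReal.ofReal d ^ (n + τ) * (V * J)) ≤
      sMean (recipIndex ⊥ τ) c d U V *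
        (ENNReal.ofReal (c ^ n) * I + ENNReal.ofReal (d ^ n) * J) := by
  rw [ENNReal.ofReal_pow hc.le, ENNReal.ofReal_pow hd.le]
  have hC : ENNReal.ofReal c ≠ 0 := by simpa using hc
  have hD : ENNReal.ofReal d ≠ 0 := by simpa using hd
  have hC' : ENNReal.ofReal c ≠ ∞ := ENNReal.ofReal_ne_top
  have hD' : ENNReal.ofReal d ≠ ∞ := ENNReal.ofReal_ne_top
  rcases hτ0.eq_or_lt with rfl | hτ0
  · rw [recipIndex_zero, sMean_bot hU hV, add_zero, ENNReal.rpow_natCast, ENNReal.rpow_natCast]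
    rcases le_total U V with hUV | hUV
    · rw [min_eq_left hUV]
      refine (min_le_left _ _).trans ?_
      rw [mul_left_comm]
      gcongr
      exact le_self_add
    · rw [min_eq_right hUV]
      refine (min_le_right _ _).trans ?_
      rw [mul_left_comm]
      gcongr
      exact le_add_self
  rw [sMean_recipIndex hτ0.ne hU hV]
  set C := ENNReal.ofReal c
  set D := ENNReal.ofReal d
  set K := min (C ^ (n + τ) * (U * I)) (D ^ (n + τ) * (V * J)) with hK
  have bound : ∀ {e T L : ℝ≥0∞}, e ≠ 0 → e ≠ ∞ → T ≠ 0 → T ≠ ∞ →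
      e ^ (n + τ) * (T * L) * (e * T ^ τ⁻¹) ^ (-τ) = e ^ n * L := by
    intro e T L he he' hT hT'
    rw [ENNReal.mul_rpow_of_nonneg _ _ (by linarith : 0 ≤ -τ), ← ENNReal.rpow_mul,
      show τ⁻¹ * -τ = -1 by rw [mul_neg, inv_mul_cancel₀ hτ0.ne], ENNReal.rpow_neg_one]
    calc _ = (e ^ (n + τ) * e ^ (-τ)) * (T * T⁻¹) * L := by ring
      _ = _ := by
        rw [← ENNReal.rpow_add _ _ he he', ENNReal.mul_inv_cancel hT hT', mul_one,
          show (n : ℝ) + τ + -τ = n by ring, ENNReal.rpow_natCast]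
  have hP0 : C * U ^ τ⁻¹ + D * V ^ τ⁻¹ ≠ 0 := weighted_sum_ne_zero (by positivity)
    (rpow_ne_zero_of_ne hU hU' _) (rpow_ne_zero_of_ne hV hV' _)
  have hPt : C * U ^ τ⁻¹ + D * V ^ τ⁻¹ ≠ ∞ := weighted_sum_ne_top
    (ENNReal.rpow_ne_top_of_ne_zero hU hU') (ENNReal.rpow_ne_top_of_ne_zero hV hV')
  calc K = (C * U ^ τ⁻¹ + D * V ^ τ⁻¹) ^ τ * (K * (C * U ^ τ⁻¹ + D * V ^ τ⁻¹) ^ (-τ)) := by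
        rw [mul_left_comm, ← ENNReal.rpow_add _ _ hP0 hPt]
        simp
    _ ≤ (C * U ^ τ⁻¹ + D * V ^ τ⁻¹) ^ τ *
        (K * ((C * U ^ τ⁻¹) ^ (-τ) + (D * V ^ τ⁻¹) ^ (-τ))) := by
      refine mul_le_mul_right (mul_le_mul_right ?_ _) _
      exact ENNReal.rpow_add_le_add_rpow _ _ (by linarith) (by linarith)
    _ ≤ _ := by
      refine mul_le_mul_right ?_ _
      rw [mul_add, ← bound (L := I) hC hC' hU hU', ← bound (L := J) hD hD' hV hV']
      exact add_le_add (mul_le_mul_left (min_le_left _ _) _)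
        (mul_le_mul_left (min_le_right _ _) _)

/-- The Dancs-Uhrin inequality: the Borell-Brascamp-Lieb inequality for means of index
`1 / τ < - 1 / n`. -/
theorem min_lintegral_le {n : ℕ} {c d τ : ℝ} (hc : 0 < c) (hd : 0 < d) (hτ : -n < τ) (hτ0 : τ ≤ 0)
    {u v w : (Fin n → ℝ) → ℝ≥0∞} (hu : Measurable u) (hv : Measurable v) (hw : Measurable w)
    (h : ∀ x y, sMean (recipIndex ⊥ τ) c d (u x) (v y) ≤ w (c • x + d • y)) :
    min (ENNReal.ofReal c ^ (n + τ) * ∫⁻ x, u x) (ENNReal.ofReal d ^ (n + τ) * ∫⁻ x, v x) ≤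
      ∫⁻ x, w x := by
  have hcd : 0 < c + d := by positivity
  have hγ : ∀ τ : ℝ, recipIndex ⊥ τ = 0 → c + d = 1 := fun τ h =>
    absurd h (recipIndex_ne_zero (by simp) τ)
  induction n generalizing τ with
  | zero => simp at hτ; linarith
  | succ n ih =>
    -- For `τ ≤ -1` a coordinate can be integrated out, which replaces `(n + 1, τ)` by `(n, τ + 1)`
    -- and leaves the exponent unchanged. Once `τ ∈ [-1, 0]`, all remaining coordinates are treated
    -- together.
    rcases le_total (-1) τ with hτ1 | hτ1
    · have fin : ∀ e : ℝ, ENNReal.ofReal e ^ (((n + 1 : ℕ) : ℝ) + τ) ≠ ∞ := fun e =>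
        ENNReal.rpow_ne_top_of_nonneg (by linarith) ENNReal.ofReal_ne_top
      refine le_lintegral_of_sMean_le volume hc.le hd.le hcd (hγ τ)
        (Φ := fun a b => min (ENNReal.ofReal c ^ (((n + 1 : ℕ) : ℝ) + τ) * a)
          (ENNReal.ofReal d ^ (((n + 1 : ℕ) : ℝ) + τ) * b)) ?_ ?_ ?_ hu hv hw h
      · rintro a b (rfl | rfl) <;> simp
      · intro a b ha hb u v hu hv
        exact (ENNReal.Tendsto.const_mul hu (Or.inr (fin c))).min
          (ENNReal.Tendsto.const_mul hv (Or.inr (fin d)))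
      · intro U V I J hU hV _ _ hU' hV' _ _
        rw [finrank_fin_fun]
        exact min_mul_le_sMean_mul hc hd hτ1 hτ0 (n + 1) hU hV hU' hV'
    · have e : ((n + 1 : ℕ) : ℝ) + τ = n + (τ + 1) := by push_cast; ring
      rw [lintegral_eq_lintegral_lintegral_cons hu, lintegral_eq_lintegral_lintegral_cons hv,
        lintegral_eq_lintegral_lintegral_cons hw, e]
      exact ih (by push_cast at hτ; linarith) (by linarith)
        (measurable_lintegral_cons hu) (measurable_lintegral_cons hv) (measurable_lintegral_cons hw)
        (sMean_lintegral_cons_le hc.le hd.le hcd (hγ τ) (MeanStep.neg hcd hτ1) hu hv hw h)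

end BorellBrascampLieb

/-! ### Measurability and reduction to measurable functions -/

theorem lpCoeffC_nonneg {p lam t : ℝ} (hlam : lam ∈ Set.Icc (0 : ℝ) 1)
    (ht : t ∈ Set.Icc (0 : ℝ) 1) : 0 ≤ lpCoeffC p lam t :=
  mul_nonneg (Real.rpow_nonneg (sub_nonneg.2 ht.2) _) (Real.rpow_nonneg (sub_nonneg.2 hlam.2) _)

theorem lpCoeffD_nonneg {p lam t : ℝ} (hlam : lam ∈ Set.Icc (0 : ℝ) 1)
    (ht : t ∈ Set.Icc (0 : ℝ) 1) : 0 ≤ lpCoeffD p lam t :=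
  mul_nonneg (Real.rpow_nonneg ht.1 _) (Real.rpow_nonneg hlam.1 _)

theorem lpCoeffC_one (lam t : ℝ) : lpCoeffC 1 lam t = 1 - t := by
  simp [lpCoeffC]

theorem lpCoeffD_one (lam t : ℝ) : lpCoeffD 1 lam t = t := by
  simp [lpCoeffD]

theorem lpCoeffC_self {p t : ℝ} (ht : t ∈ Set.Icc (0 : ℝ) 1) : lpCoeffC p t t = 1 - t := by
  rw [lpCoeffC, ← Real.rpow_add' (sub_nonneg.2 ht.2) (by norm_num)]
  simp

theorem lpCoeffD_self {p t : ℝ} (ht : t ∈ Set.Icc (0 : ℝ) 1) : lpCoeffD p t t = t := by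
  rw [lpCoeffD, ← Real.rpow_add' ht.1 (by norm_num)]
  simp

section Measurability

variable {n : ℕ}

/-- Taking `lam = t` turns the coefficients into `1 - t` and `t` for every `p`, so `f` is
quasi-concave in the usual sense; its superlevel sets are convex, hence null measurable. -/
theorem IsLpConcave.aemeasurable {p : ℝ} {s : EReal} {f : EuclideanSpace ℝ (Fin n) → ℝ≥0}
    (hf : IsLpConcave p s fun x => (f x : ℝ≥0∞)) : AEMeasurable f := by
  have hconv : ∀ a : ℝ≥0, Convex ℝ {x | a < f x} := by
    intro a
    rw [convex_iff_forall_pos]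
    intro x hx y hy c d hc hd hcd
    have ht : d ∈ Set.Icc (0 : ℝ) 1 := ⟨hd.le, by linarith⟩
    have h := hf x y d ht d ht
    rw [lpCoeffC_self ht, lpCoeffD_self ht, show 1 - d = c by linarith] at h
    have h' := (min_le_sMean (s := s) hc.le hd.le hcd
      (ne_top_of_le_ne_top ENNReal.coe_ne_top (min_le_left (f x : ℝ≥0∞) (f y)))).trans h
    rw [← ENNReal.coe_min] at h'
    have h'' : min (f x) (f y) ≤ f (c • x + d • y) := ENNReal.coe_le_coe.1 h'
    exact (lt_min hx hy).trans_le h''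
  have hnull : NullMeasurable f volume := by
    refine measurable_of_Ioi (α := ℝ≥0) (δ := NullMeasurableSpace (EuclideanSpace ℝ (Fin n)) volume)
      (f := f) fun a => ?_
    exact (hconv a).nullMeasurableSet volume
  exact hnull.aemeasurable

theorem AEMeasurable.exists_measurable_ge {α : Type*} [MeasurableSpace α] {μ : Measure α}
    {w : α → ℝ≥0∞} (hw : AEMeasurable w μ) :
    ∃ w' : α → ℝ≥0∞, Measurable w' ∧ (∀ x, w x ≤ w' x) ∧ ∫⁻ x, w' x ∂μ = ∫⁻ x, w x ∂μ := by
  classical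
  set N := toMeasurable μ {x | ¬ w x = hw.mk w x} with hN
  have hN0 : μ N = 0 := by rw [hN, measure_toMeasurable]; exact hw.ae_eq_mk
  have hNm : MeasurableSet N := measurableSet_toMeasurable _ _
  refine ⟨N.piecewise (fun _ => ∞) (hw.mk w),
    Measurable.piecewise hNm measurable_const hw.measurable_mk, fun x => ?_, ?_⟩
  · by_cases hx : x ∈ N
    · simp [hx]
    · rw [Set.piecewise_eq_of_notMem _ _ _ hx]
      by_contra h
      exact hx (subset_toMeasurable _ _ fun h' => h h'.le)
  · refine lintegral_congr_ae ?_
    have : ∀ᵐ x ∂μ, x ∉ N := measure_eq_zero_iff_ae_notMem.1 hN0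
    filter_upwards [this, hw.ae_eq_mk] with x hx hx'
    rw [Set.piecewise_eq_of_notMem _ _ _ hx, hx']

/-- The hypothesis is pointwise, so almost-everywhere modifications must respect order: `u` and `v`
are lowered and `w` is raised, without changing integrals. Raising `w` is where its a.e.
measurability is needed. The result lives on `Fin n → ℝ`, ready for slicing. -/
theorem exists_measurable_sMean_le {γ : EReal} {c d : ℝ} (hc : 0 ≤ c) (hd : 0 ≤ d)
    {u v w : EuclideanSpace ℝ (Fin n) → ℝ≥0∞} (hw : AEMeasurable w)
    (h : ∀ x y, sMean γ c d (u x) (v y) ≤ w (c • x + d • y)) :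
    ∃ u' v' w' : (Fin n → ℝ) → ℝ≥0∞, Measurable u' ∧ Measurable v' ∧ Measurable w' ∧
      ∫⁻ x, u' x = ∫⁻ x, u x ∧ ∫⁻ x, v' x = ∫⁻ x, v x ∧ ∫⁻ x, w' x = ∫⁻ x, w x ∧
      ∀ x y, sMean γ c d (u' x) (v' y) ≤ w' (c • x + d • y) := by
  obtain ⟨u', hu', huu', hui⟩ := exists_measurable_le_lintegral_eq volume u
  obtain ⟨v', hv', hvv', hvi⟩ := exists_measurable_le_lintegral_eq volume v
  obtain ⟨w', hw', hww', hwi⟩ := hw.exists_measurable_ge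
  have e := PiLp.volume_preserving_toLp (Fin n)
  refine ⟨fun x => u' (WithLp.toLp 2 x), fun x => v' (WithLp.toLp 2 x),
    fun x => w' (WithLp.toLp 2 x), hu'.comp e.measurable, hv'.comp e.measurable,
    hw'.comp e.measurable, ?_, ?_, ?_, fun x y => ?_⟩
  · rw [e.lintegral_comp hu', hui]
  · rw [e.lintegral_comp hv', hvi]
  · rw [e.lintegral_comp hw', hwi]
  · exact (sMean_mono hc hd (huu' _) (hvv' _)).trans ((h _ _).trans (hww' _))

end Measurability

/-! ### Convolutions -/

/-- Hölder's inequality `M_γ(aa', bb') ≤ M_s(a, b) M_β(a', b')` for positive real arguments. -/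
def MeanHolder (c d : ℝ) (s β γ : EReal) : Prop :=
  ∀ a b a' b' : ℝ≥0∞, a ≠ 0 → b ≠ 0 → a' ≠ 0 → b' ≠ 0 → a ≠ ∞ → b ≠ ∞ → a' ≠ ∞ → b' ≠ ∞ →
    sMean γ c d (a * a') (b * b') ≤ sMean s c d a b * sMean β c d a' b'

theorem MeanHolder.symm {c d : ℝ} {s β γ : EReal} (h : MeanHolder c d s β γ) :
    MeanHolder c d β s γ := by
  intro a b a' b' ha hb ha' hb' hat hbt hat' hbt'
  rw [mul_comm a, mul_comm b, mul_comm (sMean _ _ _ _ _)]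
  exact h _ _ _ _ ha' hb' ha hb hat' hbt' hat hbt

section Convolution

variable {n : ℕ} {p : ℝ} {s β γ : EReal} {f g : EuclideanSpace ℝ (Fin n) → ℝ≥0}

/-- Here convolution meets Borell-Brascamp-Lieb: the points `x₀ - x` and `y₀ - y` combine to `(C •
x₀ + D • y₀) - (C • x + D • y)`, so the product of the two concavity estimates bounds the third
integrand from below. -/
theorem exists_measurable_convol (hf : IsLpConcave p s fun x => (f x : ℝ≥0∞))
    (hg : IsLpConcave p β fun x => (g x : ℝ≥0∞)) {lam t : ℝ} (hlam : lam ∈ Set.Icc (0 : ℝ) 1)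
    (ht : t ∈ Set.Icc (0 : ℝ) 1)
    (hH : MeanHolder (lpCoeffC p lam t) (lpCoeffD p lam t) s β γ)
    (x₀ y₀ : EuclideanSpace ℝ (Fin n)) :
    ∃ u v w : (Fin n → ℝ) → ℝ≥0∞, Measurable u ∧ Measurable v ∧ Measurable w ∧
      ∫⁻ x, u x = convol f g x₀ ∧ ∫⁻ x, v x = convol f g y₀ ∧
      ∫⁻ x, w x = convol f g (lpCoeffC p lam t • x₀ + lpCoeffD p lam t • y₀) ∧
      ∀ x y, sMean γ (lpCoeffC p lam t) (lpCoeffD p lam t) (u x) (v y) ≤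
        w (lpCoeffC p lam t • x + lpCoeffD p lam t • y) := by
  refine exists_measurable_sMean_le (lpCoeffC_nonneg hlam ht) (lpCoeffD_nonneg hlam ht)
    (u := fun x => (f x : ℝ≥0∞) * g (x₀ - x)) (v := fun x => (f x : ℝ≥0∞) * g (y₀ - x))
    (w := fun x => (f x : ℝ≥0∞) *
      g (lpCoeffC p lam t • x₀ + lpCoeffD p lam t • y₀ - x)) ?_ fun x y => ?_
  · exact hf.aemeasurable.coe_nnreal_ennreal.mul
      (hg.aemeasurable.comp_quasiMeasurePreserving
        (quasiMeasurePreserving_sub_left volume _)).coe_nnreal_ennreal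
  · by_cases h : (f x : ℝ≥0∞) * g (x₀ - x) = 0 ∨ (f y : ℝ≥0∞) * g (y₀ - y) = 0
    · simp [sMean_of_eq_zero h]
    push Not at h
    obtain ⟨h1, h2⟩ := h
    refine (hH _ _ _ _ (left_ne_zero_of_mul h1) (left_ne_zero_of_mul h2) (right_ne_zero_of_mul h1)
      (right_ne_zero_of_mul h2) ENNReal.coe_ne_top ENNReal.coe_ne_top ENNReal.coe_ne_top
      ENNReal.coe_ne_top).trans (mul_le_mul' (hf x y lam hlam t ht) ?_)
    refine (hg (x₀ - x) (y₀ - y) lam hlam t ht).trans (le_of_eq ?_)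
    congr 2
    simp only [smul_sub]
    abel

theorem sMean_convol_le (hf : IsLpConcave p s fun x => (f x : ℝ≥0∞))
    (hg : IsLpConcave p β fun x => (g x : ℝ≥0∞)) {lam t : ℝ} (hlam : lam ∈ Set.Icc (0 : ℝ) 1)
    (ht : t ∈ Set.Icc (0 : ℝ) 1) {γ : ℕ → EReal}
    (hH : MeanHolder (lpCoeffC p lam t) (lpCoeffD p lam t) s β (γ 0))
    (hpos : 0 < lpCoeffC p lam t + lpCoeffD p lam t)
    (hγ : ∀ k, γ k = 0 → lpCoeffC p lam t + lpCoeffD p lam t = 1)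
    (hstep : ∀ k < n, MeanStep (lpCoeffC p lam t) (lpCoeffD p lam t) (γ k) (γ (k + 1)))
    (x₀ y₀ : EuclideanSpace ℝ (Fin n)) :
    sMean (γ n) (lpCoeffC p lam t) (lpCoeffD p lam t) (convol f g x₀) (convol f g y₀) ≤
      convol f g (lpCoeffC p lam t • x₀ + lpCoeffD p lam t • y₀) := by
  obtain ⟨u, v, w, hu, hv, hw, hui, hvi, hwi, h⟩ := exists_measurable_convol hf hg hlam ht hH x₀ y₀
  rw [← hui, ← hvi, ← hwi]
  exact sMean_lintegral_le (lpCoeffC_nonneg hlam ht) (lpCoeffD_nonneg hlam ht) hpos hγ hstep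
    hu hv hw h

theorem min_convol_le (hf : IsLpConcave p s fun x => (f x : ℝ≥0∞))
    (hg : IsLpConcave p β fun x => (g x : ℝ≥0∞)) {lam t : ℝ} (hlam : lam ∈ Set.Icc (0 : ℝ) 1)
    (ht : t ∈ Set.Icc (0 : ℝ) 1) {τ : ℝ}
    (hH : MeanHolder (lpCoeffC p lam t) (lpCoeffD p lam t) s β (recipIndex ⊥ τ))
    (hτ : -n < τ) (hτ0 : τ ≤ 0) (x₀ y₀ : EuclideanSpace ℝ (Fin n)) :
    min (ENNReal.ofReal (lpCoeffC p lam t) ^ (n + τ) * convol f g x₀)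
        (ENNReal.ofReal (lpCoeffD p lam t) ^ (n + τ) * convol f g y₀) ≤
      convol f g (lpCoeffC p lam t • x₀ + lpCoeffD p lam t • y₀) := by
  have hr : 0 < n + τ := by linarith
  -- A vanishing coefficient makes the minimum zero, since the exponent `n + τ` is positive.
  rcases (lpCoeffC_nonneg (p := p) hlam ht).eq_or_lt with hC | hC
  · simp [← hC, hr]
  rcases (lpCoeffD_nonneg (p := p) hlam ht).eq_or_lt with hD | hD
  · simp [← hD, hr]
  obtain ⟨u, v, w, hu, hv, hw, hui, hvi, hwi, h⟩ := exists_measurable_convol hf hg hlam ht hH x₀ y₀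
  rw [← hui, ← hvi, ← hwi]
  exact min_lintegral_le hC hD hτ hτ0 hu hv hw h

/-- For `p > 1` the vanishing coefficients force an `L_{p,s}`-concave function of negative index `s`
with finite values to vanish. -/
theorem IsLpConcave.eq_zero_of_neg (hp : 1 < p) {τ : ℝ} (hτ : τ < 0)
    (hf : IsLpConcave p (recipIndex ⊥ τ) fun x => (f x : ℝ≥0∞)) (x : EuclideanSpace ℝ (Fin n)) :
    f x = 0 := by
  by_contra h
  have hx : (f x : ℝ≥0∞) ≠ 0 := by exact_mod_cast h
  have hp' : 1 / p ≠ 0 := by positivity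
  have hq : 1 - 1 / p ≠ 0 := by
    have : 1 / p < 1 := by rw [div_lt_one (by linarith)]; exact hp
    linarith
  have hC : lpCoeffC p 1 0 = 0 := by rw [lpCoeffC, sub_self, Real.zero_rpow hq, mul_zero]
  have hD : lpCoeffD p 1 0 = 0 := by rw [lpCoeffD, Real.zero_rpow hp', zero_mul]
  -- Both coefficients vanish at `lam = 1`, `t = 0`, so the mean is `0 ^ τ = ∞`, while `f 0` is
  -- finite.
  have := hf x x 1 (by simp) 0 (by simp)
  rw [hC, hD, sMean_recipIndex hτ.ne hx hx] at this
  simp [hτ] at this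

theorem convol_eq_zero (h : (∀ x, f x = 0) ∨ ∀ x, g x = 0) (z : EuclideanSpace ℝ (Fin n)) :
    convol f g z = 0 := by
  rcases h with h | h <;> simp [convol, h]

end Convolution

/-! ### The indices -/

theorem exists_recipIndex_top {s : EReal} (hs : 0 < s) :
    ∃ σ : ℝ, 0 ≤ σ ∧ s = recipIndex ⊤ σ ∧ s⁻¹ = (σ : EReal) := by
  induction s with
  | top => exact ⟨0, le_rfl, (recipIndex_zero _).symm, by simp⟩
  | bot => simp at hs
  | coe s =>
    have hs' : 0 < s := by exact_mod_cast hs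
    exact ⟨s⁻¹, by positivity, by simp [recipIndex, hs'.ne'], (EReal.coe_inv s).symm⟩

theorem exists_recipIndex_bot {s : EReal} (hs : s < 0) (hs' : s ≠ ⊥) :
    ∃ σ : ℝ, σ < 0 ∧ s = recipIndex ⊥ σ ∧ s⁻¹ = (σ : EReal) := by
  induction s with
  | top => simp at hs
  | bot => simp at hs'
  | coe s =>
    have hs'' : s < 0 := by exact_mod_cast hs
    exact ⟨s⁻¹, by simpa using hs'', by simp [recipIndex, hs''.ne], (EReal.coe_inv s).symm⟩

theorem parallelSum_nonneg {s b : EReal} (hs : 0 ≤ s) (hb : 0 ≤ b) : 0 ≤ parallelSum s b := by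
  unfold parallelSum
  split_ifs with h1 h2 h3
  · exact hb
  · exact hs
  · exact absurd (le_antisymm (h3.1 ▸ le_add_of_nonneg_right hb) hs) h3.2
  · exact EReal.div_nonneg (mul_nonneg hs hb) (add_nonneg hs hb)

theorem parallelSum_comm {s b : EReal} : parallelSum s b = parallelSum b s := by
  unfold parallelSum
  by_cases hs : s = ⊤
  · by_cases hb : b = ⊤ <;> simp [hs, hb]
  by_cases hb : b = ⊤
  · simp [hs, hb]
  have : (s + b = 0 ∧ s ≠ 0) ↔ (b + s = 0 ∧ b ≠ 0) := by
    rw [add_comm b]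
    refine and_congr_right fun h => not_congr ⟨?_, ?_⟩
    · rintro rfl; simpa using h
    · rintro rfl; simpa using h
  rw [if_neg hs, if_neg hb, if_neg hb, if_neg hs, mul_comm s]
  simp only [this]
  rw [add_comm s]

theorem parallelSum_recipIndex {σ τ : ℝ} (hσ : 0 ≤ σ) (hτ : τ < 0)
    (h : 0 ≤ recipIndex ⊤ σ + recipIndex ⊥ τ) :
    σ + τ ≤ 0 ∧ parallelSum (recipIndex ⊤ σ) (recipIndex ⊥ τ) = recipIndex ⊥ (σ + τ) := by
  rcases hσ.eq_or_lt with rfl | hσ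
  · simp [recipIndex_zero, parallelSum, hτ.le]
  have e1 : recipIndex ⊤ σ = ((σ⁻¹ : ℝ) : EReal) := if_neg hσ.ne'
  have e2 : recipIndex ⊥ τ = ((τ⁻¹ : ℝ) : EReal) := if_neg hτ.ne
  rw [e1, e2] at h ⊢
  have h' : 0 ≤ σ⁻¹ + τ⁻¹ := by exact_mod_cast h
  have hle : σ + τ ≤ 0 := by
    have h2 : (σ + τ) = (σ⁻¹ + τ⁻¹) * (σ * τ) := by field_simp [hτ.ne]; ring
    rw [h2]
    exact mul_nonpos_of_nonneg_of_nonpos h' (mul_nonpos_of_nonneg_of_nonpos hσ.le hτ.le)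
  refine ⟨hle, ?_⟩
  unfold parallelSum recipIndex
  simp only [EReal.coe_ne_top, if_false]
  have hiff : ((σ⁻¹ : ℝ) : EReal) + ((τ⁻¹ : ℝ) : EReal) = 0 ∧ ((σ⁻¹ : ℝ) : EReal) ≠ 0 ↔
      σ + τ = 0 := by
    have h1 : ((σ⁻¹ : ℝ) : EReal) + ((τ⁻¹ : ℝ) : EReal) = 0 ↔ σ⁻¹ + τ⁻¹ = 0 := by norm_cast
    have h2 : ((σ⁻¹ : ℝ) : EReal) ≠ 0 := by exact_mod_cast (inv_pos.2 hσ).ne'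
    rw [h1, and_iff_left h2]
    have h3 : σ⁻¹ + τ⁻¹ = (σ + τ) * (σ * τ)⁻¹ := by field_simp [hτ.ne]; ring
    rw [h3, mul_eq_zero, or_iff_left (inv_ne_zero (mul_ne_zero hσ.ne' hτ.ne))]
  simp only [hiff]
  split_ifs with h0
  · rfl
  · rw [← EReal.coe_mul, ← EReal.coe_add, ← EReal.coe_div]
    congr 1
    have : σ⁻¹ + τ⁻¹ = (σ + τ) / (σ * τ) := by field_simp [hτ.ne]; ring
    rw [this]
    field_simp [hτ.ne]

/-- Translates the threshold separating the two conclusions into reciprocals. -/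
theorem neg_one_div_le_recipIndex {n : ℕ} (hn : 1 ≤ n) {ρ : ℝ} (hρ : ρ ≤ 0) :
    ((-(1 / (n : ℝ)) : ℝ) : EReal) ≤ recipIndex ⊥ ρ ↔ ρ ≤ -n := by
  have hn' : (0 : ℝ) < n := by exact_mod_cast hn
  unfold recipIndex
  split_ifs with h
  · simp only [h, le_bot_iff, EReal.coe_ne_bot, false_iff, not_le]
    linarith
  · have hρ' : ρ < 0 := lt_of_le_of_ne hρ h
    rw [EReal.coe_le_coe_iff, one_div, ← inv_neg, inv_le_inv_of_neg (by linarith) hρ']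

theorem convolIndex_eq {n : ℕ} {s β : EReal} (hs : s ≠ 0) (hβ : β ≠ 0) {ρ : ℝ}
    (hρ : s⁻¹ + β⁻¹ = (ρ : EReal)) : convolIndex n s β = recipIndex ⊥ (ρ + n) := by
  have e : s⁻¹ + β⁻¹ + (n : EReal) = ((ρ + n : ℝ) : EReal) := by rw [hρ]; norm_cast
  unfold convolIndex recipIndex
  rw [if_neg (by tauto), e]
  simp only [EReal.coe_eq_zero, EReal.coe_inv]

/-! ### The cases of the theorem, by the signs of the indices. -/

/-- For `p > 1` the convolution is zero; for `p = 1` the coefficients sum to 1. The reciprocals run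
through `ρ, ρ + 1, …, ρ + n`, and each step from `ρ + k`, `k < n`, needs `ρ + k ≤ -1`, which
together means `ρ ≤ -n`. At `ρ = -n` the chain ends at the index `⊥`. -/
theorem convol_of_neg {n : ℕ} (hn : 1 ≤ n) {p : ℝ} (hp : 1 ≤ p) {s β : EReal} (hs : s ≠ 0)
    (hβ : β ≠ 0) {ρ : ℝ} (hρ : ρ ≤ 0) (hinv : s⁻¹ + β⁻¹ = (ρ : EReal))
    (hpar : parallelSum s β = recipIndex ⊥ ρ)
    (hH : ∀ c d : ℝ, c + d = 1 → MeanHolder c d s β (recipIndex ⊥ ρ))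
    {f g : EuclideanSpace ℝ (Fin n) → ℝ≥0}
    (hf : IsLpConcave p s (fun x => (f x : ℝ≥0∞)))
    (hg : IsLpConcave p β (fun x => (g x : ℝ≥0∞)))
    (hzero : 1 < p → (∀ x, f x = 0) ∨ ∀ x, g x = 0) :
    (((-(1 / (n : ℝ)) : ℝ) : EReal) ≤ parallelSum s β →
        IsLpConcave p (convolIndex n s β) (convol f g)) ∧
      (parallelSum s β < ((-(1 / (n : ℝ)) : ℝ) : EReal) →
        IsLpQuasiConcave p (s⁻¹ + β⁻¹ + (n : EReal)).toReal (convol f g)) := by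
  rcases hp.lt_or_eq with hp | rfl
  · have h0 := convol_eq_zero (hzero hp)
    exact ⟨fun _ x y lam _ t _ => by simp [sMean_of_eq_zero, h0],
      fun _ x y lam _ t _ => by simp [h0]⟩
  have hsum : ∀ lam t, lpCoeffC 1 lam t + lpCoeffD 1 lam t = 1 := fun lam t => by
    rw [lpCoeffC_one, lpCoeffD_one]; ring
  rw [← not_le, hpar, neg_one_div_le_recipIndex hn hρ]
  constructor
  · intro h x y lam hlam t ht
    rw [convolIndex_eq hs hβ hinv]
    refine sMean_convol_le hf hg hlam ht (γ := fun k => recipIndex ⊥ (ρ + k)) ?_ ?_ ?_ ?_ x y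
    · simpa using hH _ _ (hsum lam t)
    · rw [hsum]; exact one_pos
    · exact fun _ _ => hsum lam t
    · intro k hk
      have hk' : (k : ℝ) + 1 ≤ n := by exact_mod_cast hk
      have := MeanStep.neg (c := lpCoeffC 1 lam t) (d := lpCoeffD 1 lam t) (ρ := ρ + k)
        (by rw [hsum]; exact one_pos) (by linarith)
      simpa [add_assoc] using this
  · intro h x y lam hlam t ht
    have e : (s⁻¹ + β⁻¹ + (n : EReal)).toReal = n + ρ := by
      rw [hinv, add_comm]
      norm_cast
    rw [e]
    exact min_convol_le hf hg hlam ht (hH _ _ (hsum lam t)) (not_le.1 h) hρ x y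

theorem exists_recip_of_pos_of_neg {n : ℕ} {p : ℝ} {s β : EReal} (hs : 0 < s)
    (hβ : β < 0) (hsβ : 0 ≤ s + β) :
    ∃ ρ : ℝ, ρ ≤ 0 ∧ s⁻¹ + β⁻¹ = (ρ : EReal) ∧ parallelSum s β = recipIndex ⊥ ρ ∧
      (∀ c d : ℝ, c + d = 1 → MeanHolder c d s β (recipIndex ⊥ ρ)) ∧
      ∀ g : EuclideanSpace ℝ (Fin n) → ℝ≥0, IsLpConcave p β (fun x => (g x : ℝ≥0∞)) → 1 < p →
        ∀ x, g x = 0 := by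
  have hβ' : β ≠ ⊥ := by rintro rfl; simp at hsβ
  obtain ⟨σ, hσ, rfl, hσi⟩ := exists_recipIndex_top hs
  obtain ⟨τ, hτ, rfl, hτi⟩ := exists_recipIndex_bot hβ hβ'
  obtain ⟨hle, hpar⟩ := parallelSum_recipIndex hσ hτ hsβ
  refine ⟨σ + τ, hle, by rw [hσi, hτi, EReal.coe_add], hpar, ?_, ?_⟩
  · intro c d hcd a b a' b' ha hb ha' hb' hat hbt hat' hbt'
    exact sMean_mul_le_neg (by rw [hcd]; exact one_pos) hσ hτ hle ha hb ha' hb' hat hbt hat' hbt'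
  · exact fun g hg hp x => hg.eq_zero_of_neg hp hτ x

/-- The geometric mean is multiplicative, and the arithmetic-geometric inequality enlarges its
second factor to the mean of index `β`. -/
theorem MeanHolder.zero_left {c d : ℝ} (hc : 0 ≤ c) (hd : 0 ≤ d) (hcd : c + d = 1) {β : EReal}
    (hβ : 0 ≤ β) : MeanHolder c d 0 β 0 := by
  intro a b a' b' ha hb ha' hb' _ _ hat' hbt'
  rw [sMean_zero_mul hc hd ha hb ha' hb']
  gcongr
  rcases hβ.eq_or_lt with rfl | hβ
  · exact le_rfl
  · obtain ⟨τ, hτ, rfl, -⟩ := exists_recipIndex_top hβ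
    exact sMean_zero_le_pos hc hd hcd hτ ha' hb' hat' hbt'

theorem isLpConcave_convol_of_zero {n : ℕ} {s β : EReal} (hs : 0 ≤ s) (hβ : 0 ≤ β)
    (h : s = 0 ∨ β = 0) {f g : EuclideanSpace ℝ (Fin n) → ℝ≥0}
    (hf : IsLpConcave 1 s (fun x => (f x : ℝ≥0∞)))
    (hg : IsLpConcave 1 β (fun x => (g x : ℝ≥0∞))) : IsLpConcave 1 0 (convol f g) := by
  intro x y lam hlam t ht
  have hsum : lpCoeffC 1 lam t + lpCoeffD 1 lam t = 1 := by
    rw [lpCoeffC_one, lpCoeffD_one]; ring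
  have hC := lpCoeffC_nonneg (p := 1) hlam ht
  have hD := lpCoeffD_nonneg (p := 1) hlam ht
  refine sMean_convol_le hf hg hlam ht (γ := fun _ => 0) ?_ (by rw [hsum]; exact one_pos)
    (fun _ _ => hsum) (fun _ _ => MeanStep.zero hC hD hsum) x y
  rcases h with rfl | rfl
  · exact MeanHolder.zero_left hC hD hsum hβ
  · exact (MeanHolder.zero_left hC hD hsum hs).symm

theorem isLpConcave_convol_of_pos {n : ℕ} (hn : 1 ≤ n) {p : ℝ} {s β : EReal} (hs : 0 < s)
    (hβ : 0 < β) {f g : EuclideanSpace ℝ (Fin n) → ℝ≥0}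
    (hf : IsLpConcave p s (fun x => (f x : ℝ≥0∞)))
    (hg : IsLpConcave p β (fun x => (g x : ℝ≥0∞))) :
    IsLpConcave p (convolIndex n s β) (convol f g) := by
  intro x y lam hlam t ht
  obtain ⟨σ, hσ, hsσ, hσi⟩ := exists_recipIndex_top hs
  obtain ⟨τ, hτ, hβτ, hτi⟩ := exists_recipIndex_top hβ
  have hn' : (0 : ℝ) < n := by exact_mod_cast hn
  have hpos : 0 < σ + τ + n := by positivity
  have e : convolIndex n s β = recipIndex ⊤ (σ + τ + n) := by
    rw [convolIndex_eq hs.ne' hβ.ne' (ρ := σ + τ) (by rw [hσi, hτi, EReal.coe_add]), recipIndex,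
      recipIndex, if_neg hpos.ne', if_neg hpos.ne']
  rw [e]
  have hC := lpCoeffC_nonneg (p := p) hlam ht
  have hD := lpCoeffD_nonneg (p := p) hlam ht
  -- If both coefficients vanish, the mean is `0` raised to the positive reciprocal `σ + τ + n`, so
  -- there is nothing to prove.
  rcases (add_nonneg hC hD).eq_or_lt with h0 | h0
  · have hC0 : lpCoeffC p lam t = 0 := by linarith
    have hD0 : lpCoeffD p lam t = 0 := by linarith
    by_cases h : convol f g x = 0 ∨ convol f g y = 0
    · simp [sMean_of_eq_zero h]
    · push Not at h
      rw [sMean_recipIndex hpos.ne' h.1 h.2, hC0, hD0]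
      simp [hpos]
  · refine sMean_convol_le hf hg hlam ht (γ := fun k => recipIndex ⊤ (σ + τ + k)) ?_ h0 ?_ ?_ x y
    · intro a b a' b' ha hb ha' hb' _ _ _ _
      rw [hsσ, hβτ]
      simpa using sMean_mul_le_pos hσ hτ ha hb ha' hb'
    · exact fun k h => absurd h (recipIndex_ne_zero (by simp) _)
    · intro k _
      have := MeanStep.pos (c := lpCoeffC p lam t) (d := lpCoeffD p lam t) (ρ := σ + τ + k)
        (by positivity)
      simpa [add_assoc] using this

theorem theoremt (n : ℕ) (hn : 1 ≤ n) (p : ℝ) (hp : 1 ≤ p) (s β : EReal) (hsβ : 0 ≤ s + β)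
    (h0 : p = 1 ∨ (s ≠ 0 ∧ β ≠ 0))
    (f g : EuclideanSpace ℝ (Fin n) → ℝ≥0)
    (hf : IsLpConcave p s (fun x => (f x : ℝ≥0∞)))
    (hg : IsLpConcave p β (fun x => (g x : ℝ≥0∞))) :
    (((-(1 / (n : ℝ)) : ℝ) : EReal) ≤ parallelSum s β →
        IsLpConcave p (convolIndex n s β) (convol f g)) ∧
      (parallelSum s β < ((-(1 / (n : ℝ)) : ℝ) : EReal) →
        IsLpQuasiConcave p (s⁻¹ + β⁻¹ + (n : EReal)).toReal (convol f g)) := by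
  rcases lt_or_ge s 0 with hs | hs
  · have hβ : 0 < β := by
      by_contra h
      exact absurd hsβ (not_le.2 ((add_le_add_right (not_lt.1 h) s).trans_lt (by simpa using hs)))
    obtain ⟨ρ, hρ, hinv, hpar, hH, hz⟩ := exists_recip_of_pos_of_neg hβ hs (by rwa [add_comm])
    exact convol_of_neg hn hp hs.ne hβ.ne' hρ (by rw [add_comm, hinv])
      (by rw [parallelSum_comm, hpar]) (fun c d hcd => (hH c d hcd).symm) hf hg
      fun hp => Or.inl (hz f hf hp)
  rcases lt_or_ge β 0 with hβ | hβ
  · have hs : 0 < s := by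
      by_contra h
      exact absurd hsβ (not_le.2 ((add_le_add_left (not_lt.1 h) β).trans_lt (by simpa using hβ)))
    obtain ⟨ρ, hρ, hinv, hpar, hH, hz⟩ := exists_recip_of_pos_of_neg hs hβ hsβ
    exact convol_of_neg hn hp hs.ne' hβ.ne hρ hinv hpar hH hf hg fun hp => Or.inr (hz g hg hp)
  -- With both indices nonnegative, `parallelSum s β` is nonnegative and the quasi-concave
  -- alternative cannot occur.
  refine ⟨fun _ => ?_, fun h => ?_⟩
  · by_cases h : s = 0 ∨ β = 0
    · obtain rfl : p = 1 := by tauto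
      rw [convolIndex, if_pos h]
      exact isLpConcave_convol_of_zero hs hβ h hf hg
    · push Not at h
      exact isLpConcave_convol_of_pos hn (lt_of_le_of_ne hs h.1.symm)
        (lt_of_le_of_ne hβ h.2.symm) hf hg
  · have hneg : ((-(1 / (n : ℝ)) : ℝ) : EReal) ≤ 0 := by
      have : -(1 / (n : ℝ)) ≤ 0 := by simp
      exact_mod_cast this
    exact absurd (h.trans_le hneg) (not_lt.2 (parallelSum_nonneg hs hβ))
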